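/- Let $n\ge 0$ and let $\Gamma^I_{A\dot A}$ $(I,A,\dot A=1,\dots,8)$ be real chiral gamma matrices of $\mathrm{Spin}(8)$, i.e. $\Gamma^I(\Gamma^J)^T+\Gamma^J(\Gamma^I)^T=2\delta^{IJ}=(\Gamma^I)^T\Gamma^J+(\Gamma^J)^T\Gamma^I$, with $\Gamma^{12345678}=1$ on the chiral spinors; put $\Gamma^{IJ}=-\tfrac12\left(\Gamma^I(\Gamma^J)^T-\Gamma^J(\Gamma^I)^T\right)$. Let $\gamma^1=\begin{pmatrix}0&1\\1&0\end{pmatrix}$, $\gamma^2=\begin{pmatrix}1&0\\0&-1\end{pmatrix}$, and let $\epsilon=(\epsilon^A_\alpha)$, $\alpha=1,2$, be spinors with $16$ real components. *Supersymmetries of an element.* For $P_z=\tfrac12(P_x-iP_y)\in\mathbb C^8\otimes\mathbb C^n$ ($P_x,P_y$ real), the real supersymmetries of $P_z$ are the real spinors $\epsilon$ with $(\gamma^1P_x^{Ir}+\gamma^2P_y^{Ir})\,\Gamma^I_{A\dot A}\epsilon^A=0$ for all $r,\dot A$ (equivalently $P_z^{Ir}\Gamma^I_{A\dot A}\epsilon^A_{\bar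 z}=0$, where $\epsilon_{\bar z}=\epsilon_1-i\epsilon_2$); their number is the real dimension of this space, and $P_z$ is supersymmetric if it is nonzero. For $2\mu+2\nu\le 8$ and $2\mu+\nu\le n$ the class $N(\mu,\nu)$ consists of the supersymmetric $P_z$ that are conjugate under $\mathrm O(8,\mathbb C)\times\mathrm O(n,\mathbb C)$ to $$\sum_{i=1}^{\mu}(e_{2i-1}+ie_{2i})\otimes(\hat e_{2i-1}+i\hat e_{2i})+\sum_{j=1}^{\nu}(e_{2\mu+2j-1}+ie_{2\mu+2j})\otimes\hat e_{2\mu+j},$$ where $e_I$ and $\hat e_r$ are the standard orthonormal bases. *Timelike backgrounds.* A timelike background of ungauged half-maximal three-dimensional supergravity is given, in adapted coordinates, by a connected open set $U\subseteq\mathbb R^2$, a smooth $\rho:U\to\mathbb R$ with spacetime metric $dt^2-e^{2\rho}(dx^2+dy^2)$ on $\mathbb R\times U$, and a smooth $\mathcal V:U\to\mathrm{SO}(8,n)$ (a representative of the map to $\mathrm{SO}(8,n)/\mathrm S(\mathrm O(8)\times\mathrm O(n))$). Here $\mathcal V^{-1}d\mathcal V=Q+P$ with $Q=(Q^{IJ},Q^{rs})\in\mathfrak{so}(8)\oplus\mathfrak{so}(n)$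 and $P=(P^{Ir})\in\mathbb R^8\otimes\mathbb R^n$, and the field equations $P_x^{Ir}P_y^{Ir}=0$, $P_x^{Ir}P_x^{Ir}=P_y^{Ir}P_y^{Ir}=-(\partial_x^2+\partial_y^2)\rho$ and $\sum_{i=x,y}\left(\partial_iP_i^{Ir}+Q_i^{IJ}P_i^{Jr}+Q_i^{rs}P_i^{Is}\right)=0$ hold. Its Killing spinors are the smooth $\epsilon$ on $\mathbb R\times U$ with $\partial_t\epsilon=0$, $\partial_i\epsilon-\tfrac12\omega_i\gamma^1\gamma^2\epsilon-\tfrac14Q_i^{IJ}\Gamma^{IJ}\epsilon=0$ for $i=x,y$ (where $\omega=-\partial_y\rho\,dx+\partial_x\rho\,dy$), and $e^{-\rho}(\gamma^1P_x^{Ir}+\gamma^2P_y^{Ir})\Gamma^I_{A\dot A}\epsilon^A=0$. The number of its real supersymmetries is the real dimension of the space of Killing spinors, and the background is supersymmetric if this space is nonzero. **Theorem.** 1. The number of real supersymmetries of a timelike supersymmetric background is $16$, $8$, $4$ or $2$, and for every $z\in U$ it is at most the number of real supersymmetries of the element $P_z(z)$. 2. The number of real supersymmetries of every supersymmetric element $P_z$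 is $16$, $8$, $4$ or $2$. 3. If $\mu+\nu\le4$ and $2\mu+\nu\le n$, the class $N(\mu,\nu)$ is nonempty. Every element of $N(\mu,\nu)$ has exactly $16/2^{\mu+\nu}$ real supersymmetries if $\mu+\nu<4$, and exactly $2$ if $\mu+\nu=4$. -/

import Mathlib

open scoped ContDiff Matrix

noncomputable section

namespace TimelikeSugra

/-! ### Gamma matrices -/

/-- A choice of real chiral gamma matrices for `Spin(8)`: `mat I` is the real `8 × 8` matrix
`Γ^I_{A Ȧ}` (rows: chiral index `A`, columns: anti-chiral index `Ȧ`). The last field is the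
chirality condition `Γ^{12345678} = 1` on the chiral spinors, where
`Γ^I = [[0, mat I], [-(mat I)ᵀ, 0]]` on non-chiral spinors, so that `{Γ^I, Γ^J} = -2 δ^{IJ}`. -/
structure SpinEightGamma where
  mat : Fin 8 → Matrix (Fin 8) (Fin 8) ℝ
  clifford_chiral : ∀ I J, mat I * (mat J)ᵀ + mat J * (mat I)ᵀ =
    if I = J then (2 : ℝ) • (1 : Matrix (Fin 8) (Fin 8) ℝ) else 0
  clifford_antichiral : ∀ I J, (mat I)ᵀ * mat J + (mat J)ᵀ * mat I =
    if I = J then (2 : ℝ) • (1 : Matrix (Fin 8) (Fin 8) ℝ) else 0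
  chirality : mat 0 * (mat 1)ᵀ * mat 2 * (mat 3)ᵀ * mat 4 * (mat 5)ᵀ * mat 6 * (mat 7)ᵀ = 1

/-- Integer gamma matrices from left multiplication by the octonion units. -/
def octonionGamma (I : Fin 8) : Matrix (Fin 8) (Fin 8) ℤ :=
  (![!![1,0,0,0,0,0,0,0; 0,1,0,0,0,0,0,0; 0,0,1,0,0,0,0,0; 0,0,0,1,0,0,0,0;
        0,0,0,0,1,0,0,0; 0,0,0,0,0,1,0,0; 0,0,0,0,0,0,1,0; 0,0,0,0,0,0,0,1],
     !![0,1,0,0,0,0,0,0; -1,0,0,0,0,0,0,0; 0,0,0,1,0,0,0,0; 0,0,-1,0,0,0,0,0;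
        0,0,0,0,0,1,0,0; 0,0,0,0,-1,0,0,0; 0,0,0,0,0,0,0,-1; 0,0,0,0,0,0,1,0],
     !![0,0,1,0,0,0,0,0; 0,0,0,-1,0,0,0,0; -1,0,0,0,0,0,0,0; 0,1,0,0,0,0,0,0;
        0,0,0,0,0,0,1,0; 0,0,0,0,0,0,0,1; 0,0,0,0,-1,0,0,0; 0,0,0,0,0,-1,0,0],
     !![0,0,0,1,0,0,0,0; 0,0,1,0,0,0,0,0; 0,-1,0,0,0,0,0,0; -1,0,0,0,0,0,0,0;
        0,0,0,0,0,0,0,1; 0,0,0,0,0,0,-1,0; 0,0,0,0,0,1,0,0; 0,0,0,0,-1,0,0,0],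
     !![0,0,0,0,1,0,0,0; 0,0,0,0,0,-1,0,0; 0,0,0,0,0,0,-1,0; 0,0,0,0,0,0,0,-1;
        -1,0,0,0,0,0,0,0; 0,1,0,0,0,0,0,0; 0,0,1,0,0,0,0,0; 0,0,0,1,0,0,0,0],
     !![0,0,0,0,0,1,0,0; 0,0,0,0,1,0,0,0; 0,0,0,0,0,0,0,-1; 0,0,0,0,0,0,1,0;
        0,-1,0,0,0,0,0,0; -1,0,0,0,0,0,0,0; 0,0,0,-1,0,0,0,0; 0,0,1,0,0,0,0,0],
     !![0,0,0,0,0,0,1,0; 0,0,0,0,0,0,0,1; 0,0,0,0,1,0,0,0; 0,0,0,0,0,-1,0,0;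
        0,0,-1,0,0,0,0,0; 0,0,0,1,0,0,0,0; -1,0,0,0,0,0,0,0; 0,-1,0,0,0,0,0,0],
     !![0,0,0,0,0,0,0,1; 0,0,0,0,0,0,-1,0; 0,0,0,0,0,1,0,0; 0,0,0,0,1,0,0,0;
        0,0,0,-1,0,0,0,0; 0,0,-1,0,0,0,0,0; 0,1,0,0,0,0,0,0; -1,0,0,0,0,0,0,0]] : Fin 8 → Matrix (Fin 8) (Fin 8) ℤ) I


theorem octonionGamma_chiral : ∀ I J : Fin 8,
    octonionGamma I * (octonionGamma J)ᵀ + octonionGamma J * (octonionGamma I)ᵀ =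
    if I = J then (2 : ℤ) • (1 : Matrix (Fin 8) (Fin 8) ℤ) else 0 := by
  decide +kernel

theorem octonionGamma_antichiral : ∀ I J : Fin 8,
    (octonionGamma I)ᵀ * octonionGamma J + (octonionGamma J)ᵀ * octonionGamma I =
    if I = J then (2 : ℤ) • (1 : Matrix (Fin 8) (Fin 8) ℤ) else 0 := by
  decide +kernel

theorem octonionGamma_chirality :
    octonionGamma 0 * (octonionGamma 1)ᵀ * octonionGamma 2 * (octonionGamma 3)ᵀ *
      octonionGamma 4 * (octonionGamma 5)ᵀ * octonionGamma 6 * (octonionGamma 7)ᵀ = 1 := by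
  decide +kernel

/-- Real chiral gamma matrices exist. -/
def octonionSpinEightGamma : SpinEightGamma where
  mat I := (octonionGamma I).map (Int.castRingHom ℝ)
  clifford_chiral I J := by
    have h := congrArg (fun M => M.map (Int.castRingHom ℝ)) (octonionGamma_chiral I J)
    simp only [Matrix.map_add _ (map_add (Int.castRingHom ℝ)), Matrix.map_mul,
      Matrix.transpose_map] at h
    rw [h]
    split_ifs
    · ext i j
      simp only [Matrix.map_apply, Matrix.smul_apply, Matrix.one_apply]
      by_cases hij : i = j <;> simp [hij]
    · ext i j
      simp
  clifford_antichiral I J := by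
    have h := congrArg (fun M => M.map (Int.castRingHom ℝ)) (octonionGamma_antichiral I J)
    simp only [Matrix.map_add _ (map_add (Int.castRingHom ℝ)), Matrix.map_mul,
      Matrix.transpose_map] at h
    rw [h]
    split_ifs
    · ext i j
      simp only [Matrix.map_apply, Matrix.smul_apply, Matrix.one_apply]
      by_cases hij : i = j <;> simp [hij]
    · ext i j
      simp
  chirality := by
    have h := congrArg (fun M => M.map (Int.castRingHom ℝ)) octonionGamma_chirality
    simp only [Matrix.map_mul, Matrix.transpose_map] at h
    rw [h]
    ext i j
    by_cases hij : i = j <;> simp [Matrix.one_apply, hij]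

instance : Nonempty SpinEightGamma := ⟨octonionSpinEightGamma⟩

/-- The spin matrices `Γ^{IJ}_{AB} = -Γ^{[I}_{A Ȧ} Γ^{J]}_{B Ȧ}` on chiral spinors. -/
def spinGamma (G : SpinEightGamma) (I J : Fin 8) : Matrix (Fin 8) (Fin 8) ℝ :=
  -((1 / 2 : ℝ) • (G.mat I * (G.mat J)ᵀ - G.mat J * (G.mat I)ᵀ))

/-- The spatial spacetime gamma matrices `γ^1` and `γ^2` (in the orthonormal frame). -/
def gammaOne : Matrix (Fin 2) (Fin 2) ℝ := !![0, 1; 1, 0]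

def gammaTwo : Matrix (Fin 2) (Fin 2) ℝ := !![1, 0; 0, -1]

/-- The sixteen real components `ε^A_α` of a supersymmetry parameter, as `ε α A`. -/
abbrev Spinor : Type := Fin 2 → Fin 8 → ℝ

/-! ### The algebraic (dilatino) equation -/

/-- The dilatino variation `γ^1 P_x^{Ir} Γ^I_{A Ȧ} ε^A + γ^2 P_y^{Ir} Γ^I_{A Ȧ} ε^A` (with
`P_t = 0`), with component indices `r`, the spacetime spinor index `α`, and `Ȧ = a`. -/
def dilatino (G : SpinEightGamma) {n : ℕ} (Px Py : Matrix (Fin 8) (Fin n) ℝ) (ε : Spinor)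
    (r : Fin n) (α : Fin 2) (a : Fin 8) : ℝ :=
  ∑ β, ∑ I, ∑ A, (gammaOne α β * Px I r + gammaTwo α β * Py I r) * G.mat I A a * ε β A

theorem dilatino_add (G : SpinEightGamma) {n : ℕ} (Px Py : Matrix (Fin 8) (Fin n) ℝ)
    (ε ε' : Spinor) (r : Fin n) (α : Fin 2) (a : Fin 8) :
    dilatino G Px Py (ε + ε') r α a = dilatino G Px Py ε r α a + dilatino G Px Py ε' r α a := by
  simp only [dilatino, Pi.add_apply, mul_add, Finset.sum_add_distrib]

theorem dilatino_smul (G : SpinEightGamma) {n : ℕ} (Px Py : Matrix (Fin 8) (Fin n) ℝ)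
    (c : ℝ) (ε : Spinor) (r : Fin n) (α : Fin 2) (a : Fin 8) :
    dilatino G Px Py (c • ε) r α a = c * dilatino G Px Py ε r α a := by
  simp only [dilatino, Pi.smul_apply, smul_eq_mul, Finset.mul_sum]
  refine Finset.sum_congr rfl fun β _ => Finset.sum_congr rfl fun I _ =>
    Finset.sum_congr rfl fun A _ => by ring

/-- The real vector space of solutions of the algebraic supersymmetry equation of the element
`P_z = (P_x - i P_y) / 2` of `ℂ⁸ ⊗ ℂⁿ`, so `P_x = 2 Re P_z` and `P_y = -2 Im P_z`. -/
def supersymmetries (G : SpinEightGamma) {n : ℕ} (P : Matrix (Fin 8) (Fin n) ℂ) :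
    Submodule ℝ Spinor where
  carrier := {ε | ∀ r α a, dilatino G (Matrix.of fun I s => 2 * (P I s).re)
    (Matrix.of fun I s => -2 * (P I s).im) ε r α a = 0}
  zero_mem' := by
    intro r α a
    simp [dilatino]
  add_mem' := by
    intro ε ε' h h' r α a
    rw [dilatino_add, h, h', add_zero]
  smul_mem' := by
    intro c ε h r α a
    rw [dilatino_smul, h, mul_zero]

/-- The number of real supersymmetries of an element `P_z`. -/
def numSupersymmetries (G : SpinEightGamma) {n : ℕ} (P : Matrix (Fin 8) (Fin n) ℂ) : ℕ :=
  Module.finrank ℝ (supersymmetries G P)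

/-- `P_z` is supersymmetric if it admits a nonzero supersymmetry. -/
def IsSupersymmetric (G : SpinEightGamma) {n : ℕ} (P : Matrix (Fin 8) (Fin n) ℂ) : Prop :=
  ∃ ε ∈ supersymmetries G P, ε ≠ 0

/-! ### The classes `N(μ, ν)` -/

/-- The `k`-th (counting from `0`) vector of the standard orthonormal basis of `ℂᵐ`. -/
def stdVec (m k : ℕ) : Fin m → ℂ := fun a => if (a : ℕ) = k then 1 else 0

/-- The null vector `e_k + i e_{k+1}` of `ℂᵐ`. -/
def nullVec (m k : ℕ) : Fin m → ℂ := stdVec m k + Complex.I • stdVec m (k + 1)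

/-- The normal form with `μ` summands of type `(2,2)` and `ν` summands of type `(2,1)`:
`∑_{i<μ} (e_{2i} + i e_{2i+1}) ⊗ (ê_{2i} + i ê_{2i+1})
  + ∑_{j<ν} (e_{2μ+2j} + i e_{2μ+2j+1}) ⊗ ê_{2μ+j}`, with basis vectors counted from `0`. -/
def normalForm (n μ ν : ℕ) : Matrix (Fin 8) (Fin n) ℂ :=
  ∑ i ∈ Finset.range μ, Matrix.vecMulVec (nullVec 8 (2 * i)) (nullVec n (2 * i)) +
  ∑ j ∈ Finset.range ν, Matrix.vecMulVec (nullVec 8 (2 * μ + 2 * j)) (stdVec n (2 * μ + j))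

/-- The class `N(μ, ν)`: supersymmetric elements conjugate to the normal form under the
complex orthogonal groups `O(8, ℂ) × O(n, ℂ)`, where `8 = 2 (μ + ν) + …` and
`n = 2 μ + ν + …`. The group contains the complexification of `S(O(8) × O(n))`, hence the class
contains every supersymmetric element that is conjugate to the normal form under the latter, and
it does not depend on the signs in `e_k ± i e_{k+1}`. -/
def nilpotentClass (G : SpinEightGamma) (n μ ν : ℕ) : Set (Matrix (Fin 8) (Fin n) ℂ) :=
  {P | 2 * μ + 2 * ν ≤ 8 ∧ 2 * μ + ν ≤ n ∧ IsSupersymmetric G P ∧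
    ∃ (g : Matrix (Fin 8) (Fin 8) ℂ) (h : Matrix (Fin n) (Fin n) ℂ),
      gᵀ * g = 1 ∧ hᵀ * h = 1 ∧ P = g * normalForm n μ ν * hᵀ}

/-! ### Timelike backgrounds -/

/-- The metric of signature `(8, n)` preserved by `SO(8, n)`. -/
def etaForm (n : ℕ) : Matrix (Fin 8 ⊕ Fin n) (Fin 8 ⊕ Fin n) ℝ := Matrix.fromBlocks 1 0 0 (-1)

/-- The Maurer-Cartan form `𝒱⁻¹ d𝒱` at `z = x + i y`, evaluated on the tangent vector `v`
(`v = 1` is `∂_x`, `v = i` is `∂_y`). -/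
def maurerCartan {n : ℕ} (V : ℂ → Matrix (Fin 8 ⊕ Fin n) (Fin 8 ⊕ Fin n) ℝ) (z v : ℂ) :
    Matrix (Fin 8 ⊕ Fin n) (Fin 8 ⊕ Fin n) ℝ :=
  (V z)⁻¹ * Matrix.of fun a b => fderiv ℝ (fun w => V w a b) z v

/-- The scalar current `P^{Ir}`, the `𝔭`-part of `𝒱⁻¹ d𝒱`. -/
def currentP {n : ℕ} (V : ℂ → Matrix (Fin 8 ⊕ Fin n) (Fin 8 ⊕ Fin n) ℝ) (z v : ℂ) :
    Matrix (Fin 8) (Fin n) ℝ := (maurerCartan V z v).toBlocks₁₂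

/-- The `𝔰𝔬(8)`-connection `Q^{IJ}`. -/
def connEight {n : ℕ} (V : ℂ → Matrix (Fin 8 ⊕ Fin n) (Fin 8 ⊕ Fin n) ℝ) (z v : ℂ) :
    Matrix (Fin 8) (Fin 8) ℝ := (maurerCartan V z v).toBlocks₁₁

/-- The `𝔰𝔬(n)`-connection `Q^{rs}`. -/
def connN {n : ℕ} (V : ℂ → Matrix (Fin 8 ⊕ Fin n) (Fin 8 ⊕ Fin n) ℝ) (z v : ℂ) :
    Matrix (Fin n) (Fin n) ℝ := (maurerCartan V z v).toBlocks₂₂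

/-- `∂_x ∂_x ρ + ∂_y ∂_y ρ`. -/
def flatLaplacian (ρ : ℂ → ℝ) (z : ℂ) : ℝ :=
  fderiv ℝ (fun w => fderiv ℝ ρ w 1) z 1 + fderiv ℝ (fun w => fderiv ℝ ρ w Complex.I) z Complex.I

/-- A timelike background in adapted coordinates `(t, x, y)`, `z = x + i y ∈ dom`: the metric
`dt² - e^{2ρ} (dx² + dy²)` and the `t`-independent coset representative `𝒱` with values in
`SO(8, n)`, solving the Einstein equations `R_{ij} = P_i^{Ir} P_j^{Ir}` and the scalar field
equation `D^μ P_μ = 0`. (The remaining Einstein equations are `0 = 0`, and the integrability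
equations for `P + Q` hold because `P + Q = 𝒱⁻¹ d𝒱`.) -/
structure TimelikeBackground (n : ℕ) where
  dom : Set ℂ
  isOpen_dom : IsOpen dom
  isConnected_dom : IsConnected dom
  ρ : ℂ → ℝ
  smooth_ρ : ContDiffOn ℝ ∞ ρ dom
  V : ℂ → Matrix (Fin 8 ⊕ Fin n) (Fin 8 ⊕ Fin n) ℝ
  smooth_V : ∀ a b, ContDiffOn ℝ ∞ (fun z => V z a b) dom
  V_orthogonal : ∀ z ∈ dom, (V z)ᵀ * etaForm n * V z = etaForm n
  V_det : ∀ z ∈ dom, (V z).det = 1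
  einstein_xy : ∀ z ∈ dom, ∑ I, ∑ r, currentP V z 1 I r * currentP V z Complex.I I r = 0
  einstein_xx : ∀ z ∈ dom, ∑ I, ∑ r, currentP V z 1 I r ^ 2 = -flatLaplacian ρ z
  einstein_yy : ∀ z ∈ dom, ∑ I, ∑ r, currentP V z Complex.I I r ^ 2 = -flatLaplacian ρ z
  scalar_eq : ∀ z ∈ dom, ∀ I r, ∑ i : Fin 2, (
    fderiv ℝ (fun w => currentP V w (![1, Complex.I] i) I r) z (![1, Complex.I] i)
    + ∑ J, connEight V z (![1, Complex.I] i) I J * currentP V z (![1, Complex.I] i) J r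
    + ∑ s, connN V z (![1, Complex.I] i) r s * currentP V z (![1, Complex.I] i) I s) = 0

namespace TimelikeBackground

variable {n : ℕ} (B : TimelikeBackground n)

/-- `P_z = (P_x - i P_y) / 2` at the point `z`. -/
def Pz (z : ℂ) : Matrix (Fin 8) (Fin n) ℂ := Matrix.of fun I r =>
  (1 / 2 : ℂ) * ((currentP B.V z 1 I r : ℂ) - Complex.I * (currentP B.V z Complex.I I r : ℂ))

/-- The component `ω_{12}` of the Levi-Civita connection in the frame
`(dt, e^ρ dx, e^ρ dy)`, along `v`: `ω_{12} = -∂_y ρ dx + ∂_x ρ dy`. -/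
def spinConn (z v : ℂ) : ℝ :=
  -fderiv ℝ B.ρ z Complex.I * v.re + fderiv ℝ B.ρ z 1 * v.im

/-- The spatial gravitino variation along `v` at `p = (t, z)`:
`∂_v ε - ¼ ω_{ab} γ^{ab} ε - ¼ Q^{IJ} Γ^{IJ} ε`; here `¼ ω_{ab} γ^{ab} = ½ ω_{12} γ^1 γ^2`. -/
def gravitino (G : SpinEightGamma) (ε : ℝ × ℂ → Spinor) (p : ℝ × ℂ) (v : ℂ) : Spinor :=
  fun α A => fderiv ℝ ε p (0, v) α A
    - 1 / 2 * B.spinConn p.2 v * ∑ β, (gammaOne * gammaTwo) α β * ε p β A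
    - 1 / 4 * ∑ I, ∑ J, ∑ C, connEight B.V p.2 v I J * spinGamma G I J A C * ε p α C

/-- Killing spinors on the spacetime `ℝ × dom` (extended by zero outside): smooth solutions of
the gravitino equation (whose `t`-component is `∂_t ε = 0`, as `Q_t = 0`) and of the dilatino
equation `γ^μ P_μ^{Ir} Γ^I ε = 0`, where `γ^x = e^{-ρ} γ^1` and `γ^y = e^{-ρ} γ^2`. -/
structure IsKilling (G : SpinEightGamma) (ε : ℝ × ℂ → Spinor) : Prop where
  smooth : ContDiffOn ℝ ∞ ε (Set.univ ×ˢ B.dom)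
  eq_zero_outside : ∀ p : ℝ × ℂ, p.2 ∉ B.dom → ε p = 0
  time_eq : ∀ p : ℝ × ℂ, p.2 ∈ B.dom → fderiv ℝ ε p (1, 0) = 0
  gravitino_eq : ∀ p : ℝ × ℂ, p.2 ∈ B.dom → ∀ v : ℂ, B.gravitino G ε p v = 0
  dilatino_eq : ∀ p : ℝ × ℂ, p.2 ∈ B.dom → ∀ r α a,
    dilatino G (Real.exp (-B.ρ p.2) • currentP B.V p.2 1)
      (Real.exp (-B.ρ p.2) • currentP B.V p.2 Complex.I) (ε p) r α a = 0

variable {B} in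
theorem IsKilling.differentiableAt {G : SpinEightGamma} {ε : ℝ × ℂ → Spinor}
    (h : B.IsKilling G ε) {p : ℝ × ℂ} (hp : p.2 ∈ B.dom) : DifferentiableAt ℝ ε p :=
  (h.smooth.contDiffAt ((isOpen_univ.prod B.isOpen_dom).mem_nhds ⟨Set.mem_univ _, hp⟩)
    ).differentiableAt (by simp)

/-- The real vector space of Killing spinors. -/
def killingSpinors (G : SpinEightGamma) : Submodule ℝ (ℝ × ℂ → Spinor) where
  carrier := {ε | B.IsKilling G ε}
  zero_mem' :=
    { smooth := contDiffOn_const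
      eq_zero_outside := fun _ _ => rfl
      time_eq := fun p _ => by simp
      gravitino_eq := fun p _ v => by
        ext α A
        simp [gravitino]
      dilatino_eq := fun p _ r α a => by simp [dilatino] }
  add_mem' := by
    intro ε ε' h h'
    refine ⟨h.smooth.add h'.smooth, ?_, ?_, ?_, ?_⟩
    · intro p hp
      simp [h.eq_zero_outside p hp, h'.eq_zero_outside p hp]
    · intro p hp
      rw [fderiv_add (h.differentiableAt hp) (h'.differentiableAt hp)]
      simp [h.time_eq p hp, h'.time_eq p hp]
    · intro p hp v
      have e1 := h.gravitino_eq p hp v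
      have e2 := h'.gravitino_eq p hp v
      have e : B.gravitino G (ε + ε') p v = B.gravitino G ε p v + B.gravitino G ε' p v := by
        ext α A
        simp only [gravitino, fderiv_add (h.differentiableAt hp) (h'.differentiableAt hp),
          Pi.add_apply, _root_.add_apply, mul_add, Finset.sum_add_distrib]
        ring
      rw [e, e1, e2, add_zero]
    · intro p hp r α a
      rw [Pi.add_apply, dilatino_add, h.dilatino_eq p hp, h'.dilatino_eq p hp, add_zero]
  smul_mem' := by
    intro c ε h
    refine ⟨h.smooth.const_smul c, ?_, ?_, ?_, ?_⟩
    · intro p hp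
      simp [h.eq_zero_outside p hp]
    · intro p hp
      rw [fderiv_const_smul (h.differentiableAt hp)]
      simp [h.time_eq p hp]
    · intro p hp v
      have e1 := h.gravitino_eq p hp v
      have e : B.gravitino G (c • ε) p v = c • B.gravitino G ε p v := by
        ext α A
        simp only [gravitino, fderiv_const_smul (h.differentiableAt hp), Pi.smul_apply,
          _root_.smul_apply, smul_eq_mul, mul_sub, Finset.mul_sum]
        congr 1
        · congr 1
          exact Finset.sum_congr rfl fun β _ => by ring
        · exact Finset.sum_congr rfl fun I _ => Finset.sum_congr rfl fun J _ =>
            Finset.sum_congr rfl fun C _ => by ring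
      rw [e, e1, smul_zero]
    · intro p hp r α a
      rw [Pi.smul_apply, dilatino_smul, h.dilatino_eq p hp, mul_zero]

/-- The number of real supersymmetries of a background. -/
def numKilling (G : SpinEightGamma) : ℕ := Module.finrank ℝ (B.killingSpinors G)

/-- A background is supersymmetric if it admits a nonzero Killing spinor. -/
def IsSupersymmetric (G : SpinEightGamma) : Prop := ∃ ε ∈ B.killingSpinors G, ε ≠ 0

end TimelikeBackground

end TimelikeSugra

end

/-! Two mechanisms carry the theorem: a count of spinors annihilated by null vectors, and a hidden
Clifford symmetry of the Killing spinor equations.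

Elements. With `ε ↦ ε_1 - i ε_2`, the supersymmetries of `P` become the complex chiral spinors
killed by Clifford multiplication with the column span `W` of `P`. Since `v w + w v = 2 v·w`, a
nonzero such spinor forces `W` to be isotropic, so `dim W ≤ 4`. Every additional null direction
halves the space of killed spinors of both chiralities together (`finrank_posKer_add_negKer`): its
dimension is `16 / 2^k` for `k = dim W`. For `k < 4` a non-null vector orthogonal to `W` exchanges
the chiralities, so they share equally; for `k = 4` a single spinor line is left, of one chirality.
Hence the count depends only on the rank of `P`, which on `N(μ, ν)` is `μ + ν`. The class is
nonempty because a reflection in `O(8, ℂ)` corrects a wrong chirality.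

Backgrounds. A Killing spinor has constant norm, so the Killing spinors embed into the complex space
`E` of their values at a point `z`; `E` lies in the annihilator of `P_z`, which gives the upper
bound. For the dimension of `E`, sum the two-form bilinears of a basis of Killing spinors to `b` and
their squared norms to `l`. The dilatino equation gives `b P_x = -l P_y` and `b P_y = l P_x`, so the
covariantly constant operator `T = l² + b²` kills `P`. Applied to the columns of `𝒱`, it yields
parallel vectors orthogonal to `P`; products of two of them map Killing spinors to Killing spinors
(`isKilling_cliffordAct`). So `E` is invariant under the even Clifford algebra of the range of `T`,
while `s ↦ l s + i b s` embeds `ker T` into the vectors that annihilate `E`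
(`slash_familyEmbedding`).

Linear algebra finishes (`finrank_mem_of_invariant`). If `E` contains a non-null spinor, `T` is
invertible and `E` is everything. Otherwise `dim E ≤ 4`, and dimension `3` is impossible: it would
leave `T` a range large enough to contain anticommuting invertible operators on `E`, which force
even dimension. -/

namespace TimelikeSugra

/-! ### Clifford multiplication, over `ℝ` for bilinears and over `ℂ` for annihilators -/

section Clifford

variable {R : Type*} [CommRing R] [Algebra ℝ R]

/-- Clifford multiplication `v_I Γ^I` by a vector with coefficients in a real algebra. -/
def slash (G : SpinEightGamma) (v : Fin 8 → R) : Matrix (Fin 8) (Fin 8) R :=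
  ∑ I, v I • (G.mat I).map (algebraMap ℝ R)

theorem slash_add (G : SpinEightGamma) (v w : Fin 8 → R) :
    slash G (v + w) = slash G v + slash G w := by
  simp [slash, add_smul, Finset.sum_add_distrib]

theorem slash_smul (G : SpinEightGamma) (c : R) (v : Fin 8 → R) :
    slash G (c • v) = c • slash G v := by
  simp [slash, mul_smul, Finset.smul_sum]

theorem slash_zero (G : SpinEightGamma) : slash G (0 : Fin 8 → R) = 0 := by
  simp [slash]

theorem slash_neg (G : SpinEightGamma) (v : Fin 8 → R) : slash G (-v) = -slash G v := by
  simp [slash]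

theorem slash_transpose (G : SpinEightGamma) (v : Fin 8 → R) :
    (slash G v)ᵀ = ∑ I, v I • (G.mat I)ᵀ.map (algebraMap ℝ R) := by
  simp [slash, Matrix.transpose_sum, Matrix.transpose_map]

theorem sum_sum_clifford (v w : Fin 8 → R) :
    ∑ I, ∑ J, (v I * w J) • (if I = J then (2 : ℝ) • (1 : Matrix (Fin 8) (Fin 8) ℝ) else 0).map
      (algebraMap ℝ R) = (2 * (v ⬝ᵥ w)) • (1 : Matrix (Fin 8) (Fin 8) R) := by
  have h : ∀ I J : Fin 8, (if I = J then (2 : ℝ) • (1 : Matrix (Fin 8) (Fin 8) ℝ) else 0).map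
      (algebraMap ℝ R) = if I = J then (2 : R) • (1 : Matrix (Fin 8) (Fin 8) R) else 0 := by
    intro I J
    split_ifs
    · ext i j
      by_cases hij : i = j <;> simp [hij, map_ofNat]
    · ext i j
      simp
  simp_rw [h]
  simp [dotProduct, Finset.sum_mul, Finset.sum_smul, smul_smul, mul_comm (2 : R)]

theorem slash_mul_transpose (G : SpinEightGamma) (v w : Fin 8 → R) :
    slash G v * (slash G w)ᵀ + slash G w * (slash G v)ᵀ = (2 * (v ⬝ᵥ w)) • 1 := by
  rw [← sum_sum_clifford]
  simp_rw [← G.clifford_chiral, slash_transpose, slash, Finset.sum_mul_sum]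
  rw [Finset.sum_comm (f := fun i j => (w i • _) * (v j • _))]
  rw [← Finset.sum_add_distrib]
  refine Finset.sum_congr rfl fun I _ => ?_
  rw [← Finset.sum_add_distrib]
  refine Finset.sum_congr rfl fun J _ => ?_
  rw [Matrix.map_add _ (map_add _), Matrix.map_mul, Matrix.map_mul, smul_add]
  simp [smul_smul, mul_comm]

theorem transpose_slash_mul (G : SpinEightGamma) (v w : Fin 8 → R) :
    (slash G v)ᵀ * slash G w + (slash G w)ᵀ * slash G v = (2 * (v ⬝ᵥ w)) • 1 := by
  rw [← sum_sum_clifford]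
  simp_rw [← G.clifford_antichiral, slash_transpose, slash, Finset.sum_mul_sum]
  rw [Finset.sum_comm (f := fun i j => (w i • _) * (v j • _))]
  rw [← Finset.sum_add_distrib]
  refine Finset.sum_congr rfl fun I _ => ?_
  rw [← Finset.sum_add_distrib]
  refine Finset.sum_congr rfl fun J _ => ?_
  rw [Matrix.map_add _ (map_add _), Matrix.map_mul, Matrix.map_mul, smul_add]
  simp [smul_smul, mul_comm]

/-- The anticommutator as a rule for moving one vector past another: orthogonal vectors give a sign,
and `v = w` gives the square `v·v`. -/
theorem slash_mulVec_transpose (G : SpinEightGamma) (v w ψ : Fin 8 → R) :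
    slash G v *ᵥ ((slash G w)ᵀ *ᵥ ψ) =
      (2 * (v ⬝ᵥ w)) • ψ - slash G w *ᵥ ((slash G v)ᵀ *ᵥ ψ) := by
  rw [eq_sub_iff_add_eq, Matrix.mulVec_mulVec, Matrix.mulVec_mulVec, ← Matrix.add_mulVec,
    slash_mul_transpose, Matrix.smul_mulVec, Matrix.one_mulVec]

theorem transpose_slash_mulVec (G : SpinEightGamma) (v w ψ : Fin 8 → R) :
    (slash G v)ᵀ *ᵥ (slash G w *ᵥ ψ) =
      (2 * (v ⬝ᵥ w)) • ψ - (slash G w)ᵀ *ᵥ (slash G v *ᵥ ψ) := by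
  rw [eq_sub_iff_add_eq, Matrix.mulVec_mulVec, Matrix.mulVec_mulVec, ← Matrix.add_mulVec,
    transpose_slash_mul, Matrix.smul_mulVec, Matrix.one_mulVec]

end Clifford

/-! ### Annihilators of spaces of vectors -/

/-- The chiral complex spinors annihilated by all vectors of `W`. -/
def posKer (G : SpinEightGamma) (W : Submodule ℂ (Fin 8 → ℂ)) : Submodule ℂ (Fin 8 → ℂ) where
  carrier := {ψ | ∀ v ∈ W, (slash G v)ᵀ *ᵥ ψ = 0}
  zero_mem' := fun v _ => Matrix.mulVec_zero _
  add_mem' := fun h h' v hv => by rw [Matrix.mulVec_add, h v hv, h' v hv, add_zero]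
  smul_mem' := fun c ψ h v hv => by rw [Matrix.mulVec_smul, h v hv, smul_zero]

/-- The anti-chiral complex spinors annihilated by all vectors of `W`. -/
def negKer (G : SpinEightGamma) (W : Submodule ℂ (Fin 8 → ℂ)) : Submodule ℂ (Fin 8 → ℂ) where
  carrier := {ψ | ∀ v ∈ W, slash G v *ᵥ ψ = 0}
  zero_mem' := fun v _ => Matrix.mulVec_zero _
  add_mem' := fun h h' v hv => by rw [Matrix.mulVec_add, h v hv, h' v hv, add_zero]
  smul_mem' := fun c ψ h v hv => by rw [Matrix.mulVec_smul, h v hv, smul_zero]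

/-- The complex bilinear form `v_I w_I`. -/
def dotForm : LinearMap.BilinForm ℂ (Fin 8 → ℂ) := dotProductBilin ℂ ℂ

theorem dotForm_apply (v w : Fin 8 → ℂ) : dotForm v w = v ⬝ᵥ w := rfl

theorem dotForm_isRefl : dotForm.IsRefl := by
  intro v w h
  rw [dotForm_apply] at h ⊢
  rw [dotProduct_comm, h]

theorem dotForm_nondegenerate : dotForm.Nondegenerate := by
  refine dotForm_isRefl.nondegenerate_iff_separatingLeft.2 ?_
  intro v h
  exact dotProduct_eq_zero _ h

theorem finrank_le_of_injOn {K V V' : Type*} [Field K] [AddCommGroup V] [Module K V]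
    [AddCommGroup V'] [Module K V'] [FiniteDimensional K V'] (f : V →ₗ[K] V') {p : Submodule K V}
    {q : Submodule K V'} (h : ∀ x ∈ p, f x ∈ q) (hf : ∀ x ∈ p, f x = 0 → x = 0) :
    Module.finrank K p ≤ Module.finrank K q := by
  refine LinearMap.finrank_le_finrank_of_injective (f := f.restrict h) ?_
  rw [← LinearMap.ker_eq_bot, LinearMap.ker_eq_bot']
  rintro ⟨x, hx⟩ hx0
  exact Subtype.ext (hf x hx (congrArg Subtype.val hx0))

theorem finrank_eq_map_add_inf_ker {K V V' : Type*} [Field K] [AddCommGroup V]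
    [Module K V] [AddCommGroup V'] [Module K V'] [FiniteDimensional K V] (f : V →ₗ[K] V')
    (p : Submodule K V) :
    Module.finrank K p = Module.finrank K (p.map f) +
      Module.finrank K (p ⊓ LinearMap.ker f : Submodule K V) := by
  rw [← LinearMap.finrank_range_add_finrank_ker (f.domRestrict p), LinearMap.range_domRestrict,
    LinearMap.ker_domRestrict, ← Submodule.finrank_map_subtype_eq p (Submodule.comap _ _),
    Submodule.map_comap_subtype]

/-- A subspace of `ℂ⁸` on which the bilinear form vanishes. -/
def IsIsotropic (W : Submodule ℂ (Fin 8 → ℂ)) : Prop := ∀ v ∈ W, ∀ w ∈ W, v ⬝ᵥ w = 0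

theorem isIsotropic_of_dotProduct_self {W : Submodule ℂ (Fin 8 → ℂ)}
    (h : ∀ v ∈ W, v ⬝ᵥ v = 0) : IsIsotropic W := by
  intro v hv w hw
  have h1 := h _ (W.add_mem hv hw)
  rw [add_dotProduct, dotProduct_add, dotProduct_add, h v hv, h w hw, dotProduct_comm w v] at h1
  linear_combination h1 / 2

/-- An isotropic `W` is contained in its orthogonal complement, of dimension `8 - dim W`. -/
theorem IsIsotropic.finrank_le {W : Submodule ℂ (Fin 8 → ℂ)} (h : IsIsotropic W) :
    Module.finrank ℂ W ≤ 4 := by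
  have h1 : W ≤ dotForm.orthogonal W := fun v hv w hw => h w hw v hv
  have h2 := Submodule.finrank_mono h1
  rw [LinearMap.BilinForm.finrank_orthogonal dotForm_nondegenerate, Module.finrank_fin_fun] at h2
  omega

/-- The orthogonal complement has dimension greater than `4`, too large to be isotropic. -/
theorem IsIsotropic.exists_orthogonal {W : Submodule ℂ (Fin 8 → ℂ)}
    (hW : Module.finrank ℂ W < 4) : ∃ u : Fin 8 → ℂ, (∀ v ∈ W, v ⬝ᵥ u = 0) ∧ u ⬝ᵥ u ≠ 0 := by
  by_contra! h
  have h1 : IsIsotropic (dotForm.orthogonal W) :=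
    isIsotropic_of_dotProduct_self fun u hu => h u fun v hv => hu v hv
  have h2 := h1.finrank_le
  rw [LinearMap.BilinForm.finrank_orthogonal dotForm_nondegenerate, Module.finrank_fin_fun] at h2
  omega

/-- Apply `v w + w v = 2 v·w` to `ψ`: the left side vanishes. -/
theorem isIsotropic_of_posKer {G : SpinEightGamma} {W : Submodule ℂ (Fin 8 → ℂ)} {ψ : Fin 8 → ℂ}
    (hψ : ψ ∈ posKer G W) (h0 : ψ ≠ 0) : IsIsotropic W := by
  intro v hv w hw
  have h := slash_mulVec_transpose G v w ψ
  rw [hψ v hv, hψ w hw, Matrix.mulVec_zero, Matrix.mulVec_zero, sub_zero] at h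
  have := (smul_eq_zero.1 h.symm).resolve_right h0
  simpa using this

/-- Multiplication by a non-null `u` orthogonal to `W` anticommutes with `W` and squares to a
nonzero scalar, so it embeds each kernel into the other. A maximal isotropic `W` admits no such `u`,
and there the chiralities differ. -/
theorem finrank_posKer_eq_negKer (G : SpinEightGamma) {W : Submodule ℂ (Fin 8 → ℂ)}
    (hW : Module.finrank ℂ W < 4) :
    Module.finrank ℂ (posKer G W) = Module.finrank ℂ (negKer G W) := by
  obtain ⟨u, hu, huu⟩ := IsIsotropic.exists_orthogonal hW
  have hinv : ∀ ψ : Fin 8 → ℂ, (2 * (u ⬝ᵥ u)) • ψ = 0 → ψ = 0 := fun ψ h =>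
    (smul_eq_zero.1 h).resolve_left (mul_ne_zero two_ne_zero huu)
  apply le_antisymm
  · refine finrank_le_of_injOn (slash G u)ᵀ.mulVecLin ?_ ?_
    · intro ψ hψ v hv
      rw [Matrix.mulVecLin_apply]
      rw [slash_mulVec_transpose, hψ v hv, hu v hv]
      simp
    · intro ψ _ h
      rw [Matrix.mulVecLin_apply] at h
      have h2 := slash_mulVec_transpose G u u ψ
      rw [h, Matrix.mulVec_zero, sub_zero] at h2
      exact hinv ψ h2.symm
  · refine finrank_le_of_injOn (slash G u).mulVecLin ?_ ?_
    · intro ψ hψ v hv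
      rw [Matrix.mulVecLin_apply, transpose_slash_mulVec, hψ v hv, hu v hv]
      simp
    · intro ψ _ h
      rw [Matrix.mulVecLin_apply] at h
      have h2 := transpose_slash_mulVec G u u ψ
      rw [h, Matrix.mulVec_zero, sub_zero] at h2
      exact hinv ψ h2.symm

/-- Rank-nullity for multiplication by `v` on the chiral kernel of the hyperplane `W ∩ w^⊥`. Since
`W` is this hyperplane plus the line of `v`, the kernel is the chiral kernel of `W`; since `v² = 0`,
the image lies in the anti-chiral kernel of `W`, and multiplication by `w` shows that it is all of
it. -/
theorem finrank_posKer_inf_ker (G : SpinEightGamma) {W : Submodule ℂ (Fin 8 → ℂ)}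
    (hW : IsIsotropic W) {v w : Fin 8 → ℂ} (hv : v ∈ W) (hwv : w ⬝ᵥ v = 1) :
    Module.finrank ℂ (posKer G (W ⊓ LinearMap.ker (dotForm w))) =
      Module.finrank ℂ (posKer G W) + Module.finrank ℂ (negKer G W) := by
  have hdecomp : ∀ x ∈ W, ∃ y ∈ W ⊓ LinearMap.ker (dotForm w), ∃ c : ℂ, x = y + c • v := by
    intro x hx
    refine ⟨x - (w ⬝ᵥ x) • v, ⟨W.sub_mem hx (W.smul_mem _ hv), ?_⟩, w ⬝ᵥ x, by abel⟩
    change w ⬝ᵥ _ = 0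
    rw [dotProduct_sub, dotProduct_smul, hwv, smul_eq_mul, mul_one, sub_self]
  have hw0 : ∀ x ∈ W ⊓ LinearMap.ker (dotForm w), w ⬝ᵥ x = 0 := fun x hx => hx.2
  rw [finrank_eq_map_add_inf_ker (slash G v)ᵀ.mulVecLin, add_comm]
  have hker : posKer G (W ⊓ LinearMap.ker (dotForm w)) ⊓
      LinearMap.ker (slash G v)ᵀ.mulVecLin = posKer G W := by
    ext ψ
    constructor
    · rintro ⟨h1, h2⟩ x hx
      obtain ⟨y, hy, c, rfl⟩ := hdecomp x hx
      rw [slash_add, slash_smul, Matrix.transpose_add, Matrix.transpose_smul, Matrix.add_mulVec,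
        Matrix.smul_mulVec, h1 y hy, zero_add]
      exact smul_eq_zero_of_right _ h2
    · intro h
      exact ⟨fun x hx => h x hx.1, h v hv⟩
  have hmap : (posKer G (W ⊓ LinearMap.ker (dotForm w))).map (slash G v)ᵀ.mulVecLin =
      negKer G W := by
    ext χ
    constructor
    · rintro ⟨ψ, hψ, rfl⟩ x hx
      obtain ⟨y, hy, c, rfl⟩ := hdecomp x hx
      rw [Matrix.mulVecLin_apply, slash_mulVec_transpose, add_dotProduct, smul_dotProduct,
        hW y hy.1 v hv, hW v hv v hv, slash_add, Matrix.transpose_add, slash_smul,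
        Matrix.transpose_smul, Matrix.add_mulVec, hψ y hy, Matrix.smul_mulVec,
        zero_add, zero_add, Matrix.mulVec_smul]
      have := slash_mulVec_transpose G v v ψ
      rw [hW v hv v hv, mul_zero, zero_smul, zero_sub, self_eq_neg] at this
      rw [this]
      simp
    · intro hχ
      -- The factor comes from `v w χ = 2 (v·w) χ - w v χ = 2 χ`.
      refine ⟨(1 / 2 : ℂ) • (slash G w *ᵥ χ), ?_, ?_⟩
      · refine Submodule.smul_mem _ _ fun x hx => ?_
        rw [transpose_slash_mulVec, hχ x hx.1, dotProduct_comm, hw0 x hx]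
        simp
      · rw [map_smul, Matrix.mulVecLin_apply, transpose_slash_mulVec, hχ v hv, dotProduct_comm, hwv]
        simp [smul_smul]
  rw [hker, hmap]

theorem finrank_inf_ker_dotForm {W : Submodule ℂ (Fin 8 → ℂ)} {v w : Fin 8 → ℂ} (hv : v ∈ W)
    (hwv : w ⬝ᵥ v = 1) :
    Module.finrank ℂ W = Module.finrank ℂ (W ⊓ LinearMap.ker (dotForm w) :
      Submodule ℂ (Fin 8 → ℂ)) + 1 := by
  rw [finrank_eq_map_add_inf_ker (dotForm w) W, add_comm]
  congr 1
  have : W.map (dotForm w) = ⊤ := by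
    rw [eq_top_iff]
    rintro c -
    refine ⟨c • v, W.smul_mem _ hv, ?_⟩
    rw [map_smul, dotForm_apply, hwv, smul_eq_mul, mul_one]
  rw [this, finrank_top, Module.finrank_self]

/-- Induction over hyperplanes: the hyperplane has dimension at most `3`, so its two kernels have
equal dimension, and the chiral one has the combined dimension of both kernels of `W`. Thus each
step halves the sum. -/
theorem finrank_posKer_add_negKer (G : SpinEightGamma) (k : ℕ) :
    ∀ W : Submodule ℂ (Fin 8 → ℂ), IsIsotropic W → Module.finrank ℂ W = k →
      (Module.finrank ℂ (posKer G W) + Module.finrank ℂ (negKer G W)) * 2 ^ k = 16 := by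
  induction k with
  | zero =>
    intro W _ hk
    have hW : W = ⊥ := Submodule.finrank_eq_zero.1 hk
    have h1 : posKer G W = ⊤ := by
      rw [eq_top_iff]
      rintro ψ - v hv
      rw [hW, Submodule.mem_bot] at hv
      rw [hv, slash_zero, Matrix.transpose_zero, Matrix.zero_mulVec]
    have h2 : negKer G W = ⊤ := by
      rw [eq_top_iff]
      rintro ψ - v hv
      rw [hW, Submodule.mem_bot] at hv
      rw [hv, slash_zero, Matrix.zero_mulVec]
    rw [h1, h2, finrank_top, Module.finrank_fin_fun]
    norm_num
  | succ k ih =>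
    intro W hW hk
    obtain ⟨v, hv, hv0⟩ : ∃ v ∈ W, v ≠ 0 := by
      by_contra! h
      rw [(Submodule.eq_bot_iff W).2 h, finrank_bot] at hk
      omega
    obtain ⟨w, hwv⟩ : ∃ w : Fin 8 → ℂ, w ⬝ᵥ v = 1 := by
      obtain ⟨i, hi⟩ := Function.ne_iff.1 hv0
      refine ⟨Pi.single i (v i)⁻¹, ?_⟩
      rw [single_dotProduct]
      exact inv_mul_cancel₀ hi
    have hdim := finrank_inf_ker_dotForm hv hwv
    have hk' : Module.finrank ℂ (W ⊓ LinearMap.ker (dotForm w) :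
      Submodule ℂ (Fin 8 → ℂ)) = k := by omega
    have h := ih (W ⊓ LinearMap.ker (dotForm w)) (fun x hx y hy => hW x hx.1 y hy.1) hk'
    have hlt := hW.finrank_le
    have h2 := finrank_posKer_eq_negKer G (W := W ⊓ LinearMap.ker (dotForm w)) (by omega)
    rw [← h2, finrank_posKer_inf_ker G hW hv hwv] at h
    rw [pow_succ]
    linarith

theorem two_mul_finrank_posKer (G : SpinEightGamma) {W : Submodule ℂ (Fin 8 → ℂ)}
    (hW : IsIsotropic W) (hk : Module.finrank ℂ W < 4) :
    Module.finrank ℂ (posKer G W) * 2 ^ Module.finrank ℂ W = 8 := by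
  have h := finrank_posKer_add_negKer G _ W hW rfl
  rw [← finrank_posKer_eq_negKer G hk] at h
  linarith

theorem finrank_posKer_of_finrank_eq_four (G : SpinEightGamma) {W : Submodule ℂ (Fin 8 → ℂ)}
    (hW : IsIsotropic W) (hk : Module.finrank ℂ W = 4) :
    Module.finrank ℂ (posKer G W) + Module.finrank ℂ (negKer G W) = 1 := by
  have h := finrank_posKer_add_negKer G _ W hW hk
  omega

/-! ### Supersymmetries of an element as annihilators -/

/-- The identification `ε ↦ ε_1 - i ε_2` of real spinors with complex chiral spinors. -/
def spinorEquiv : Spinor ≃ₗ[ℝ] (Fin 8 → ℂ) where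
  toFun ε A := (ε 0 A : ℂ) - Complex.I * ε 1 A
  invFun ψ := ![fun A => (ψ A).re, fun A => -(ψ A).im]
  map_add' ε ε' := by
    ext A
    simp only [Pi.add_apply]
    push_cast
    ring
  map_smul' c ε := by
    ext A
    simp only [Pi.smul_apply, smul_eq_mul, RingHom.id_apply, Complex.real_smul]
    push_cast
    ring
  left_inv ε := by
    ext α A
    fin_cases α <;> simp
  right_inv ψ := by
    ext A
    apply Complex.ext <;> simp

theorem spinorEquiv_apply (ε : Spinor) (A : Fin 8) :
    spinorEquiv ε A = (ε 0 A : ℂ) - Complex.I * ε 1 A := rfl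

/-- The real and imaginary parts of `(P_x - i P_y)(ε_1 - i ε_2)` are, up to sign, the two
spacetime-spinor components of the dilatino variation. -/
theorem slash_mulVec_spinorEquiv (G : SpinEightGamma) {n : ℕ} (Px Py : Matrix (Fin 8) (Fin n) ℝ)
    (ε : Spinor) (r : Fin n) (a : Fin 8) :
    ((slash G fun I => (1 / 2 : ℂ) * ((Px I r : ℂ) - Complex.I * (Py I r : ℂ)))ᵀ *ᵥ
      spinorEquiv ε) a =
      (1 / 2 : ℂ) * (dilatino G Px Py ε r 1 a - Complex.I * dilatino G Px Py ε r 0 a) := by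
  rw [slash_transpose, Matrix.sum_mulVec, Finset.sum_apply]
  simp only [Matrix.mulVec, dotProduct, dilatino, Fin.sum_univ_two, gammaOne, gammaTwo,
    spinorEquiv_apply]
  push_cast
  simp only [Finset.mul_sum, ← Finset.sum_add_distrib, ← Finset.sum_sub_distrib]
  refine Finset.sum_congr rfl fun I _ => Finset.sum_congr rfl fun A _ => ?_
  simp
  ring_nf
  simp
  ring

theorem dilatino_eq_zero_iff (G : SpinEightGamma) {n : ℕ} (Px Py : Matrix (Fin 8) (Fin n) ℝ)
    (ε : Spinor) (r : Fin n) :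
    (∀ α a, dilatino G Px Py ε r α a = 0) ↔
      (slash G fun I => (1 / 2 : ℂ) * ((Px I r : ℂ) - Complex.I * (Py I r : ℂ)))ᵀ *ᵥ
        spinorEquiv ε = 0 := by
  rw [funext_iff]
  simp only [slash_mulVec_spinorEquiv, Pi.zero_apply]
  constructor
  · intro h a
    simp [h]
  · intro h α a
    have h1 := (mul_eq_zero.1 (h a)).resolve_left (by norm_num)
    have h2 := Complex.ext_iff.1 h1
    fin_cases α
    · simpa using h2.2
    · simpa using h2.1

/-- The column space of an element of `ℂ⁸ ⊗ ℂⁿ`. -/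
def columnSpan {n : ℕ} (P : Matrix (Fin 8) (Fin n) ℂ) : Submodule ℂ (Fin 8 → ℂ) :=
  Submodule.span ℂ (Set.range P.col)

theorem mem_posKer_span {G : SpinEightGamma} {s : Set (Fin 8 → ℂ)} {ψ : Fin 8 → ℂ} :
    ψ ∈ posKer G (Submodule.span ℂ s) ↔ ∀ v ∈ s, (slash G v)ᵀ *ᵥ ψ = 0 := by
  refine ⟨fun h v hv => h v (Submodule.subset_span hv), fun h v hv => ?_⟩
  induction hv using Submodule.span_induction with
  | mem v hv => exact h v hv
  | zero => rw [slash_zero, Matrix.transpose_zero, Matrix.zero_mulVec]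
  | add v w _ _ h1 h2 => rw [slash_add, Matrix.transpose_add, Matrix.add_mulVec, h1, h2, add_zero]
  | smul c v _ h1 =>
    rw [slash_smul, Matrix.transpose_smul, Matrix.smul_mulVec, h1, smul_zero]

theorem mem_supersymmetries_iff {G : SpinEightGamma} {n : ℕ} {P : Matrix (Fin 8) (Fin n) ℂ}
    {ε : Spinor} : ε ∈ supersymmetries G P ↔ spinorEquiv ε ∈ posKer G (columnSpan P) := by
  rw [columnSpan, mem_posKer_span, Set.forall_mem_range]
  change (∀ r α a, _ = 0) ↔ _
  refine forall_congr' fun r => ?_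
  rw [dilatino_eq_zero_iff]
  have : (fun I => (1 / 2 : ℂ) * (((Matrix.of fun I s => 2 * (P I s).re) I r : ℝ) -
      Complex.I * ((Matrix.of fun I s => -2 * (P I s).im) I r : ℝ))) = P.col r := by
    ext I
    apply Complex.ext <;> simp
  rw [this]

theorem numSupersymmetries_eq (G : SpinEightGamma) {n : ℕ} (P : Matrix (Fin 8) (Fin n) ℂ) :
    numSupersymmetries G P = 2 * Module.finrank ℂ (posKer G (columnSpan P)) := by
  rw [← finrank_real_of_complex, numSupersymmetries]
  have h : (supersymmetries G P).map (spinorEquiv : Spinor →ₗ[ℝ] (Fin 8 → ℂ)) =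
      (posKer G (columnSpan P)).restrictScalars ℝ := by
    ext ψ
    rw [Submodule.mem_map_equiv, mem_supersymmetries_iff, LinearEquiv.apply_symm_apply]
    rfl
  rw [← LinearEquiv.finrank_map_eq spinorEquiv (supersymmetries G P), h]
  rfl

theorem isSupersymmetric_iff {G : SpinEightGamma} {n : ℕ} {P : Matrix (Fin 8) (Fin n) ℂ} :
    IsSupersymmetric G P ↔ ∃ ψ ∈ posKer G (columnSpan P), ψ ≠ 0 := by
  constructor
  · rintro ⟨ε, hε, h0⟩
    exact ⟨spinorEquiv ε, mem_supersymmetries_iff.1 hε, by simpa using h0⟩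
  · rintro ⟨ψ, hψ, h0⟩
    refine ⟨spinorEquiv.symm ψ, mem_supersymmetries_iff.2 (by simpa using hψ), by simpa using h0⟩

theorem finrank_columnSpan {n : ℕ} (P : Matrix (Fin 8) (Fin n) ℂ) :
    Module.finrank ℂ (columnSpan P) = P.rank :=
  (Matrix.rank_eq_finrank_span_cols P).symm

theorem IsSupersymmetric.isIsotropic {G : SpinEightGamma} {n : ℕ} {P : Matrix (Fin 8) (Fin n) ℂ}
    (h : IsSupersymmetric G P) : IsIsotropic (columnSpan P) := by
  obtain ⟨ψ, hψ, h0⟩ := isSupersymmetric_iff.1 h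
  exact isIsotropic_of_posKer hψ h0

theorem IsSupersymmetric.rank_le {G : SpinEightGamma} {n : ℕ} {P : Matrix (Fin 8) (Fin n) ℂ}
    (h : IsSupersymmetric G P) : P.rank ≤ 4 := by
  rw [← finrank_columnSpan]
  exact h.isIsotropic.finrank_le

theorem IsSupersymmetric.numSupersymmetries_of_lt {G : SpinEightGamma} {n : ℕ}
    {P : Matrix (Fin 8) (Fin n) ℂ} (h : IsSupersymmetric G P) (hP : P.rank < 4) :
    numSupersymmetries G P = 16 / 2 ^ P.rank := by
  rw [numSupersymmetries_eq]
  rw [← finrank_columnSpan] at hP ⊢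
  have h2 := two_mul_finrank_posKer G h.isIsotropic hP
  symm
  apply Nat.div_eq_of_eq_mul_left (by positivity)
  linarith

/-- At rank `4` the two chiralities share a total of one complex dimension; supersymmetry says that
it is the chiral one. -/
theorem IsSupersymmetric.numSupersymmetries_of_eq {G : SpinEightGamma} {n : ℕ}
    {P : Matrix (Fin 8) (Fin n) ℂ} (h : IsSupersymmetric G P) (hP : P.rank = 4) :
    numSupersymmetries G P = 2 := by
  rw [numSupersymmetries_eq]
  rw [← finrank_columnSpan] at hP
  have h2 := finrank_posKer_of_finrank_eq_four G h.isIsotropic hP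
  obtain ⟨ψ, hψ, h0⟩ := isSupersymmetric_iff.1 h
  have h3 : Module.finrank ℂ (posKer G (columnSpan P)) ≠ 0 := by
    intro h3
    rw [Submodule.finrank_eq_zero] at h3
    rw [h3] at hψ
    exact h0 ((Submodule.mem_bot ℂ).1 hψ)
  omega

theorem IsSupersymmetric.numSupersymmetries_mem {G : SpinEightGamma} {n : ℕ}
    {P : Matrix (Fin 8) (Fin n) ℂ} (h : IsSupersymmetric G P) :
    numSupersymmetries G P ∈ ({16, 8, 4, 2} : Set ℕ) := by
  rcases h.rank_le.lt_or_eq with hr | hr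
  · rw [h.numSupersymmetries_of_lt hr]
    interval_cases P.rank <;> simp
  · rw [h.numSupersymmetries_of_eq hr]
    simp

/-! ### The normal forms -/

theorem normalForm_apply (n μ ν : ℕ) (a : Fin 8) (r : Fin n) :
    normalForm n μ ν a r =
      ∑ i ∈ Finset.range μ, nullVec 8 (2 * i) a * nullVec n (2 * i) r +
      ∑ j ∈ Finset.range ν, nullVec 8 (2 * μ + 2 * j) a * stdVec n (2 * μ + j) r := by
  simp [normalForm, Matrix.sum_apply, Matrix.vecMulVec_apply]

theorem columnSpan_normalForm_le (n μ ν : ℕ) :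
    columnSpan (normalForm n μ ν) ≤
      Submodule.span ℂ (Set.range fun i : Fin (μ + ν) => nullVec 8 (2 * i)) := by
  refine Submodule.span_le.2 ?_
  rintro _ ⟨r, rfl⟩
  have hcol : (normalForm n μ ν).col r =
      ∑ i ∈ Finset.range μ, nullVec n (2 * i) r • nullVec 8 (2 * i) +
      ∑ j ∈ Finset.range ν, stdVec n (2 * μ + j) r • nullVec 8 (2 * μ + 2 * j) := by
    ext a
    simp [normalForm_apply, mul_comm]
  rw [hcol]
  refine Submodule.add_mem _ (Submodule.sum_mem _ fun i hi => ?_)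
    (Submodule.sum_mem _ fun j hj => ?_)
  · rw [Finset.mem_range] at hi
    exact Submodule.smul_mem _ _ (Submodule.subset_span ⟨⟨i, by omega⟩, rfl⟩)
  · rw [Finset.mem_range] at hj
    refine Submodule.smul_mem _ _ (Submodule.subset_span ⟨⟨μ + j, by omega⟩, ?_⟩)
    rw [← mul_add]

theorem rank_normalForm_le (n μ ν : ℕ) : (normalForm n μ ν).rank ≤ μ + ν := by
  rw [← finrank_columnSpan]
  refine (Submodule.finrank_mono (columnSpan_normalForm_le n μ ν)).trans ?_
  exact (finrank_range_le_card _).trans_eq (Fintype.card_fin _)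

theorem stdVec_apply (m k : ℕ) (a : Fin m) : stdVec m k a = if (a : ℕ) = k then 1 else 0 := rfl

theorem nullVec_apply (m k : ℕ) (a : Fin m) :
    nullVec m k a = (if (a : ℕ) = k then 1 else 0) + Complex.I * if (a : ℕ) = k + 1 then 1 else 0 :=
  rfl

theorem nullVec_two_mul (m i j : ℕ) (a : Fin m) (ha : (a : ℕ) = 2 * j) :
    nullVec m (2 * i) a = if i = j then 1 else 0 := by
  rw [nullVec_apply, if_neg (by omega : ¬(a : ℕ) = 2 * i + 1), mul_zero, add_zero]
  exact if_congr (by omega) rfl rfl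

/-- There is an identity submatrix of size `μ + ν`. The rows are the even positions, which avoid the
imaginary entries; the columns are `2 i` for the first `μ` summands and `2 μ + (i - μ) = μ + i` for
the others. -/
theorem le_rank_normalForm (n μ ν : ℕ) (h : μ + ν ≤ 4) (hn : 2 * μ + ν ≤ n) :
    μ + ν ≤ (normalForm n μ ν).rank := by
  let rows : Fin (μ + ν) → Fin 8 := fun i => ⟨2 * i, by omega⟩
  let cols : Fin (μ + ν) → Fin n := fun i =>
    ⟨if (i : ℕ) < μ then 2 * i else μ + i, by split_ifs <;> omega⟩
  have hsub : (normalForm n μ ν).submatrix rows cols = 1 := by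
    ext i j
    rw [Matrix.submatrix_apply, normalForm_apply]
    have e1 : ∀ k, nullVec 8 (2 * k) (rows i) = if k = i then 1 else 0 :=
      fun k => nullVec_two_mul 8 k i _ rfl
    have e2 : ∀ k, nullVec 8 (2 * μ + 2 * k) (rows i) = if μ + k = i then 1 else 0 := by
      intro k
      rw [← mul_add]
      exact nullVec_two_mul 8 (μ + k) i _ rfl
    simp only [e1, e2, ite_mul, one_mul, zero_mul]
    rw [Finset.sum_ite_eq' (Finset.range μ)]
    by_cases hi : (i : ℕ) < μ
    · rw [if_pos (Finset.mem_range.2 hi), Finset.sum_eq_zero (fun k _ => if_neg (by omega)),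
        add_zero]
      by_cases hj : (j : ℕ) < μ
      · rw [nullVec_two_mul n i j _ (if_pos hj), Matrix.one_apply]
        exact if_congr (by rw [Fin.ext_iff]) rfl rfl
      · have hc : (cols j : ℕ) = μ + j := if_neg hj
        rw [nullVec_apply, if_neg (by omega), if_neg (by omega),
          Matrix.one_apply_ne (by rintro rfl; exact hj hi)]
        simp
    · rw [if_neg (by simpa using hi), zero_add,
        Finset.sum_eq_single ((i : ℕ) - μ) (fun k _ hk => if_neg (by omega))
          (fun hk => absurd (Finset.mem_range.2 (by omega)) hk), if_pos (by omega), stdVec_apply,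
        Matrix.one_apply]
      refine if_congr ?_ rfl rfl
      rw [Fin.ext_iff]
      by_cases hj : (j : ℕ) < μ
      · have hc : (cols j : ℕ) = 2 * j := if_pos hj
        omega
      · have hc : (cols j : ℕ) = μ + j := if_neg hj
        omega
  have hr := Matrix.rank_submatrix_le (normalForm n μ ν) rows cols
  rwa [hsub, Matrix.rank_one, Fintype.card_fin] at hr

theorem rank_normalForm {n μ ν : ℕ} (h : μ + ν ≤ 4) (hn : 2 * μ + ν ≤ n) :
    (normalForm n μ ν).rank = μ + ν :=
  (rank_normalForm_le n μ ν).antisymm (le_rank_normalForm n μ ν h hn)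

/-- Of the conjugation only invertibility of `g` and `h` matters, since the number of
supersymmetries is determined by the rank. -/
theorem rank_of_mem_nilpotentClass {G : SpinEightGamma} {n μ ν : ℕ}
    {P : Matrix (Fin 8) (Fin n) ℂ} (hP : P ∈ nilpotentClass G n μ ν) : P.rank = μ + ν := by
  obtain ⟨h1, h2, -, g, h, hg, hh, rfl⟩ := hP
  have hg' : IsUnit g.det := (Matrix.isUnit_iff_isUnit_det g).1 (IsUnit.of_mul_eq_one_right _ hg)
  have hh' : IsUnit hᵀ.det := (Matrix.isUnit_iff_isUnit_det hᵀ).1 (IsUnit.of_mul_eq_one _ hh)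
  rw [Matrix.rank_mul_eq_left_of_isUnit_det _ _ hh', Matrix.rank_mul_eq_right_of_isUnit_det _ _ hg',
    rank_normalForm (by omega) h2]

theorem isIsotropic_span {s : Set (Fin 8 → ℂ)} (h : ∀ v ∈ s, ∀ w ∈ s, v ⬝ᵥ w = 0) :
    IsIsotropic (Submodule.span ℂ s) := by
  intro v hv w hw
  induction hv, hw using Submodule.span_induction₂ with
  | mem_mem v w hv hw => exact h v hv w hw
  | zero_left w hw => exact zero_dotProduct w
  | zero_right v hv => exact dotProduct_zero v
  | add_left v w x _ _ _ h1 h2 => rw [add_dotProduct, h1, h2, add_zero]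
  | add_right v w x _ _ _ h1 h2 => rw [dotProduct_add, h1, h2, add_zero]
  | smul_left c v w _ _ h1 => rw [smul_dotProduct, h1, smul_zero]
  | smul_right c v w _ _ h1 => rw [dotProduct_smul, h1, smul_zero]

theorem nullVec_dotProduct {i j : ℕ} (hi : i < 4) (hj : j < 4) :
    nullVec 8 (2 * i) ⬝ᵥ nullVec 8 (2 * j) = 0 := by
  interval_cases i <;> interval_cases j <;> simp [dotProduct, Fin.sum_univ_eight, nullVec_apply]

theorem isIsotropic_normalForm {n μ ν : ℕ} (h : μ + ν ≤ 4) :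
    IsIsotropic (columnSpan (normalForm n μ ν)) := by
  have hiso : IsIsotropic (Submodule.span ℂ (Set.range fun i : Fin (μ + ν) => nullVec 8 (2 * i))) := by
    refine isIsotropic_span ?_
    rintro _ ⟨i, rfl⟩ _ ⟨j, rfl⟩
    exact nullVec_dotProduct (by omega) (by omega)
  exact fun v hv w hw =>
    hiso v (columnSpan_normalForm_le n μ ν hv) w (columnSpan_normalForm_le n μ ν hw)

/-- The reflection `v ↦ 2 v_1 e_1 - v`. -/
def axisReflection : Matrix (Fin 8) (Fin 8) ℂ :=
  Matrix.diagonal fun I => if I = 0 then 1 else -1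

theorem axisReflection_mulVec (v : Fin 8 → ℂ) :
    axisReflection *ᵥ v =
      (2 * ((Pi.single 0 1 : Fin 8 → ℂ) ⬝ᵥ v)) • (Pi.single 0 1 : Fin 8 → ℂ) - v := by
  ext I
  rw [axisReflection, Matrix.mulVec_diagonal, single_dotProduct]
  by_cases hI : I = 0
  · subst hI
    simp
    ring
  · simp [hI]

theorem axisReflection_transpose_mul : axisReflectionᵀ * axisReflection = 1 := by
  rw [axisReflection, Matrix.diagonal_transpose, Matrix.diagonal_mul_diagonal,
    ← Matrix.diagonal_one]
  congr 1
  ext I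
  split_ifs <;> simp

/-- For the unit vector `u = e_1`, the reflected vector `v' = 2 (u·v) u - v` satisfies `v' u = u v`.
Hence `χ` killed by `v` gives `u χ`, of the opposite chirality, killed by `v'`. -/
theorem isSupersymmetric_axisReflection_mul {G : SpinEightGamma} {n : ℕ}
    {P : Matrix (Fin 8) (Fin n) ℂ} {χ : Fin 8 → ℂ} (hχ : χ ∈ negKer G (columnSpan P))
    (h0 : χ ≠ 0) : IsSupersymmetric G (axisReflection * P) := by
  set u : Fin 8 → ℂ := Pi.single 0 1 with hu
  have huu : u ⬝ᵥ u = 1 := by simp [hu]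
  have h1 : (slash G u)ᵀ *ᵥ (slash G u *ᵥ χ) = χ := by
    have h2 := transpose_slash_mulVec G u u χ
    rw [huu, eq_sub_iff_add_eq, ← two_smul ℂ, mul_one] at h2
    exact smul_right_injective _ (two_ne_zero (α := ℂ)) h2
  refine isSupersymmetric_iff.2 ⟨slash G u *ᵥ χ, ?_, ?_⟩
  · rw [columnSpan, mem_posKer_span]
    rintro _ ⟨r, rfl⟩
    have hcol : (axisReflection * P).col r = (2 * (u ⬝ᵥ P.col r)) • u + (-P.col r) := by
      rw [← sub_eq_add_neg, ← axisReflection_mulVec]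
      rfl
    have hr : slash G (P.col r) *ᵥ χ = 0 := hχ _ (Submodule.subset_span ⟨r, rfl⟩)
    rw [hcol, slash_add, slash_smul, slash_neg, Matrix.transpose_add, Matrix.transpose_smul,
      Matrix.transpose_neg, Matrix.add_mulVec, Matrix.smul_mulVec, Matrix.neg_mulVec, h1,
      transpose_slash_mulVec, hr, Matrix.mulVec_zero, sub_zero, dotProduct_comm u, add_neg_cancel]
  · intro h2
    rw [h2, Matrix.mulVec_zero] at h1
    exact h0 h1.symm

/-- The column span of the normal form is isotropic, so it kills a nonzero spinor of some chirality.
If only anti-chiral ones occur, the reflection moves the normal form to a supersymmetric element of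
the same orbit. -/
theorem nilpotentClass_nonempty (G : SpinEightGamma) {n μ ν : ℕ} (h : μ + ν ≤ 4)
    (hn : 2 * μ + ν ≤ n) : (nilpotentClass G n μ ν).Nonempty := by
  by_cases hs : IsSupersymmetric G (normalForm n μ ν)
  · exact ⟨normalForm n μ ν, by omega, hn, hs, 1, 1, by simp, by simp, by simp⟩
  · have hpos : posKer G (columnSpan (normalForm n μ ν)) = ⊥ := by
      rw [Submodule.eq_bot_iff]
      intro ψ hψ
      by_contra h0
      exact hs (isSupersymmetric_iff.2 ⟨ψ, hψ, h0⟩)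
    have hneg : negKer G (columnSpan (normalForm n μ ν)) ≠ ⊥ := by
      intro hneg
      have hk := finrank_posKer_add_negKer G _ _ (isIsotropic_normalForm (n := n) h) rfl
      rw [hpos, hneg, finrank_bot] at hk
      simp at hk
    obtain ⟨χ, hχ, h0⟩ := Submodule.exists_mem_ne_zero_of_ne_bot hneg
    exact ⟨axisReflection * normalForm n μ ν, by omega, hn,
      isSupersymmetric_axisReflection_mul hχ h0, axisReflection, 1, axisReflection_transpose_mul,
      by simp, by simp⟩

/-! ### Spaces of spinors invariant under an even Clifford algebra -/

/-- The composition law `|v ψ|² = |v|² |ψ|²`, polarised in the vector. -/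
theorem transpose_slash_dotProduct {R : Type*} [CommRing R] [Algebra ℝ R] (G : SpinEightGamma)
    (u v ψ : Fin 8 → R) :
    2 * (((slash G u)ᵀ *ᵥ ψ) ⬝ᵥ ((slash G v)ᵀ *ᵥ ψ)) = 2 * (u ⬝ᵥ v) * (ψ ⬝ᵥ ψ) := by
  have h := congrArg (fun χ => ψ ⬝ᵥ χ) (slash_mulVec_transpose G u v ψ)
  simp only [dotProduct_sub, dotProduct_smul, smul_eq_mul] at h
  rw [Matrix.dotProduct_mulVec, Matrix.dotProduct_mulVec ψ (slash G v), ← Matrix.mulVec_transpose,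
    ← Matrix.mulVec_transpose, dotProduct_comm ((slash G v)ᵀ *ᵥ ψ)] at h
  linear_combination h

/-- The vectors that annihilate all spinors of `E`. -/
def vecKer (G : SpinEightGamma) (E : Submodule ℂ (Fin 8 → ℂ)) : Submodule ℂ (Fin 8 → ℂ) where
  carrier := {v | ∀ ψ ∈ E, (slash G v)ᵀ *ᵥ ψ = 0}
  zero_mem' := fun ψ _ => by rw [slash_zero, Matrix.transpose_zero, Matrix.zero_mulVec]
  add_mem' := fun h h' ψ hψ => by
    rw [slash_add, Matrix.transpose_add, Matrix.add_mulVec, h ψ hψ, h' ψ hψ, add_zero]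
  smul_mem' := fun c v h ψ hψ => by
    rw [slash_smul, Matrix.transpose_smul, Matrix.smul_mulVec, h ψ hψ, smul_zero]

/-- By the composition law `v` is orthogonal to every `u`. So a non-null spinor has no nonzero
annihilating vector, not even a null one. -/
theorem eq_zero_of_slash_eq_zero (G : SpinEightGamma) {v ψ : Fin 8 → ℂ} (hψ : ψ ⬝ᵥ ψ ≠ 0)
    (h : (slash G v)ᵀ *ᵥ ψ = 0) : v = 0 := by
  refine dotProduct_eq_zero _ fun u => ?_
  have h1 := transpose_slash_dotProduct G v u ψ
  rw [h, zero_dotProduct, mul_zero] at h1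
  simpa [hψ] using h1.symm

/-- The complexification of a real vector. -/
def complexVec : (Fin 8 → ℝ) →ₗ[ℝ] (Fin 8 → ℂ) where
  toFun s I := s I
  map_add' s t := by ext; simp
  map_smul' c s := by ext; simp

theorem complexVec_apply (s : Fin 8 → ℝ) (I : Fin 8) : complexVec s I = s I := rfl

theorem complexVec_dotProduct (s t : Fin 8 → ℝ) :
    complexVec s ⬝ᵥ complexVec t = ((s ⬝ᵥ t : ℝ) : ℂ) := by
  simp [dotProduct, complexVec_apply]

theorem exists_complexVec (v : Fin 8 → ℂ) :
    ∃ s t : Fin 8 → ℝ, v = complexVec s + Complex.I • complexVec t := by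
  refine ⟨fun I => (v I).re, fun I => (v I).im, ?_⟩
  ext I
  simp [complexVec_apply, mul_comm Complex.I, Complex.re_add_im]

/-- For a real unit vector `u`, the map `v ↦ u v ψ` from `ℂ⁸` to `E` is injective. -/
theorem finrank_eq_eight_of_invariant (G : SpinEightGamma) {E : Submodule ℂ (Fin 8 → ℂ)}
    {ψ : Fin 8 → ℂ} (hψE : ψ ∈ E) (hψ : ψ ⬝ᵥ ψ ≠ 0)
    (hE : ∀ s t : Fin 8 → ℝ, ∀ φ ∈ E,
      slash G (complexVec s) *ᵥ ((slash G (complexVec t))ᵀ *ᵥ φ) ∈ E) :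
    Module.finrank ℂ E = 8 := by
  apply le_antisymm
  · simpa using E.finrank_le
  · let u : Fin 8 → ℝ := Pi.single 0 1
    let f : (Fin 8 → ℂ) →ₗ[ℂ] (Fin 8 → ℂ) :=
      { toFun := fun v => slash G (complexVec u) *ᵥ ((slash G v)ᵀ *ᵥ ψ)
        map_add' := fun v w => by
          rw [slash_add, Matrix.transpose_add, Matrix.add_mulVec, Matrix.mulVec_add]
        map_smul' := fun c v => by
          rw [slash_smul, Matrix.transpose_smul, Matrix.smul_mulVec, Matrix.mulVec_smul]
          rfl }
    have h := finrank_le_of_injOn f (p := ⊤) (q := E) (fun v _ => ?_) (fun v _ hv => ?_)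
    · simpa using h
    · obtain ⟨s, t, rfl⟩ := exists_complexVec v
      rw [map_add, map_smul]
      exact E.add_mem (hE u s ψ hψE) (E.smul_mem _ (hE u t ψ hψE))
    · have hu : slash G (complexVec u) *ᵥ ((slash G v)ᵀ *ᵥ ψ) = 0 := hv
      have h1 := transpose_slash_mulVec G (complexVec u) (complexVec u) ((slash G v)ᵀ *ᵥ ψ)
      rw [hu, Matrix.mulVec_zero, sub_zero, complexVec_dotProduct] at h1
      refine eq_zero_of_slash_eq_zero G hψ ?_
      simpa [u] using h1.symm

theorem exists_mem_orthogonal {R : Submodule ℝ (Fin 8 → ℝ)} (hR : 3 ≤ Module.finrank ℝ R)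
    (a b : Fin 8 → ℝ) : ∃ s ∈ R, s ≠ 0 ∧ a ⬝ᵥ s = 0 ∧ b ⬝ᵥ s = 0 := by
  have key : ∀ (p : Submodule ℝ (Fin 8 → ℝ)) (a : Fin 8 → ℝ), Module.finrank ℝ p ≤
      Module.finrank ℝ (p ⊓ LinearMap.ker (dotProductBilin ℝ ℝ a) :
        Submodule ℝ (Fin 8 → ℝ)) + 1 := by
    intro p a
    rw [finrank_eq_map_add_inf_ker (dotProductBilin ℝ ℝ a) p, add_comm]
    have := (p.map (dotProductBilin ℝ ℝ a)).finrank_le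
    rw [Module.finrank_self] at this
    omega
  have h1 := key R a
  have h2 := key (R ⊓ LinearMap.ker (dotProductBilin ℝ ℝ a)) b
  obtain ⟨s, hs, h0⟩ := Submodule.exists_mem_ne_zero_of_ne_bot
    (p := (R ⊓ LinearMap.ker (dotProductBilin ℝ ℝ a)) ⊓ LinearMap.ker (dotProductBilin ℝ ℝ b))
    (by
      intro h
      rw [h, finrank_bot] at h2
      omega)
  exact ⟨s, hs.1.1, h0, hs.1.2, hs.2⟩

/-- Compare determinants: `det A det B = (-1)^d det B det A` with both factors nonzero. -/
theorem even_finrank_of_anticommute {V : Type*} [AddCommGroup V] [Module ℂ V]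
    [FiniteDimensional ℂ V] {A B : V →ₗ[ℂ] V} (hA : Function.Injective A)
    (hB : Function.Injective B) (hAB : A ∘ₗ B = -(B ∘ₗ A)) : Even (Module.finrank ℂ V) := by
  have hA' : LinearMap.det A ≠ 0 := fun h => by
    have := LinearMap.bot_lt_ker_of_det_eq_zero h
    rw [LinearMap.ker_eq_bot.2 hA] at this
    exact lt_irrefl _ this
  have hB' : LinearMap.det B ≠ 0 := fun h => by
    have := LinearMap.bot_lt_ker_of_det_eq_zero h
    rw [LinearMap.ker_eq_bot.2 hB] at this
    exact lt_irrefl _ this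
  have h := congrArg LinearMap.det hAB
  rw [← neg_one_smul ℂ, LinearMap.det_smul, LinearMap.det_comp, LinearMap.det_comp] at h
  have h1 : ((-1 : ℂ) ^ Module.finrank ℂ V - 1) * (LinearMap.det A * LinearMap.det B) = 0 := by
    linear_combination -h
  rcases mul_eq_zero.1 h1 with h2 | h2
  · exact neg_one_pow_eq_one_iff_even (by norm_num) |>.1 (sub_eq_zero.1 h2)
  · exact absurd h2 (mul_ne_zero hA' hB')

theorem slash_mulVec_injective (G : SpinEightGamma) {s t : Fin 8 → ℝ} (hs : s ≠ 0) (ht : t ≠ 0)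
    {φ : Fin 8 → ℂ} (h : slash G (complexVec s) *ᵥ ((slash G (complexVec t))ᵀ *ᵥ φ) = 0) :
    φ = 0 := by
  have hs' : (s ⬝ᵥ s) ≠ 0 := fun h => hs (dotProduct_self_eq_zero.1 h)
  have ht' : (t ⬝ᵥ t) ≠ 0 := fun h => ht (dotProduct_self_eq_zero.1 h)
  have h1 := transpose_slash_mulVec G (complexVec s) (complexVec s)
    ((slash G (complexVec t))ᵀ *ᵥ φ)
  rw [h, Matrix.mulVec_zero, sub_zero, complexVec_dotProduct] at h1
  have h2 : (slash G (complexVec t))ᵀ *ᵥ φ = 0 := by simpa [hs'] using h1.symm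
  have h3 := slash_mulVec_transpose G (complexVec t) (complexVec t) φ
  rw [h2, Matrix.mulVec_zero, sub_zero, complexVec_dotProduct] at h3
  simpa [ht'] using h3.symm

/-- For mutually orthogonal nonzero `a`, `b`, `c` in `R`, the products `a b` and `a c` are
invertible on `E` and anticommute. -/
theorem even_finrank_of_invariant (G : SpinEightGamma) {E : Submodule ℂ (Fin 8 → ℂ)}
    {R : Submodule ℝ (Fin 8 → ℝ)} (hR : 3 ≤ Module.finrank ℝ R)
    (hE : ∀ s ∈ R, ∀ t ∈ R, ∀ φ ∈ E,
      slash G (complexVec s) *ᵥ ((slash G (complexVec t))ᵀ *ᵥ φ) ∈ E) :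
    Even (Module.finrank ℂ E) := by
  obtain ⟨a, ha, ha0, -, -⟩ := exists_mem_orthogonal hR 0 0
  obtain ⟨b, hb, hb0, hab, -⟩ := exists_mem_orthogonal hR a 0
  obtain ⟨c, hc, hc0, hac, hbc⟩ := exists_mem_orthogonal hR a b
  let op : ∀ s ∈ R, ∀ t ∈ R, E →ₗ[ℂ] E := fun s hs t ht =>
    ((slash G (complexVec s)).mulVecLin ∘ₗ (slash G (complexVec t))ᵀ.mulVecLin).restrict
      fun φ hφ => hE s hs t ht φ hφ
  have hop : ∀ s hs t ht, s ≠ 0 → t ≠ 0 → Function.Injective (op s hs t ht) := by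
    intro s hs t ht hs0 ht0
    rw [← LinearMap.ker_eq_bot, LinearMap.ker_eq_bot']
    rintro ⟨φ, hφ⟩ h
    exact Subtype.ext (slash_mulVec_injective G hs0 ht0 (congrArg Subtype.val h))
  refine even_finrank_of_anticommute (hop a ha b hb ha0 hb0) (hop a ha c hc ha0 hc0) ?_
  ext1 ⟨φ, hφ⟩
  apply Subtype.ext
  change slash G (complexVec a) *ᵥ ((slash G (complexVec b))ᵀ *ᵥ (slash G (complexVec a) *ᵥ
    ((slash G (complexVec c))ᵀ *ᵥ φ))) = -(slash G (complexVec a) *ᵥ ((slash G (complexVec c))ᵀ *ᵥ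
    (slash G (complexVec a) *ᵥ ((slash G (complexVec b))ᵀ *ᵥ φ))))
  have e1 : complexVec b ⬝ᵥ complexVec a = 0 := by
    rw [complexVec_dotProduct, dotProduct_comm, hab, Complex.ofReal_zero]
  have e2 : complexVec c ⬝ᵥ complexVec a = 0 := by
    rw [complexVec_dotProduct, dotProduct_comm, hac, Complex.ofReal_zero]
  have e3 : complexVec b ⬝ᵥ complexVec c = 0 := by
    rw [complexVec_dotProduct, hbc, Complex.ofReal_zero]
  rw [transpose_slash_mulVec G (complexVec b) (complexVec a),
    transpose_slash_mulVec G (complexVec c) (complexVec a),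
    slash_mulVec_transpose G (complexVec b) (complexVec c), e1, e2, e3]
  simp [Matrix.mulVec_neg]

/-- The annihilator of `E` is isotropic, and its chiral kernel contains `E`. Two independent
annihilating vectors would leave at most `8 / 2² = 2` dimensions, too few for `E`. -/
theorem finrank_vecKer_le_one (G : SpinEightGamma) {E : Submodule ℂ (Fin 8 → ℂ)}
    (hE : Module.finrank ℂ E = 3) : Module.finrank ℂ (vecKer G E) ≤ 1 := by
  have hle : E ≤ posKer G (vecKer G E) := fun ψ hψ v hv => hv ψ hψ
  have hE0 : E ≠ ⊥ := by
    rintro rfl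
    rw [finrank_bot] at hE
    omega
  obtain ⟨ψ, hψ, h0⟩ := Submodule.exists_mem_ne_zero_of_ne_bot hE0
  have hiso := isIsotropic_of_posKer (hle hψ) h0
  have h4 := hiso.finrank_le
  have h3 := Submodule.finrank_mono hle
  by_contra! h
  rcases h4.lt_or_eq with h4 | h4
  · have h5 := two_mul_finrank_posKer G hiso h4
    have h6 : 3 * 2 ^ 2 ≤ Module.finrank ℂ (posKer G (vecKer G E)) *
        2 ^ Module.finrank ℂ (vecKer G E) :=
      Nat.mul_le_mul (by omega) (Nat.pow_le_pow_right (by norm_num) h)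
    omega
  · have h5 := finrank_posKer_of_finrank_eq_four G hiso h4
    omega

/-- A nonzero space of spinors that is invariant under the even Clifford algebra of a real space
of vectors has dimension `1`, `2`, `4` or `8`, if that real space is the range of an operator whose
kernel embeds into the annihilator of the spinors. -/
theorem finrank_mem_of_invariant (G : SpinEightGamma) {E : Submodule ℂ (Fin 8 → ℂ)} (hE0 : E ≠ ⊥)
    (T : (Fin 8 → ℝ) →ₗ[ℝ] (Fin 8 → ℝ))
    (hE : ∀ s t : Fin 8 → ℝ, ∀ φ ∈ E,
      slash G (complexVec (T s)) *ᵥ ((slash G (complexVec (T t)))ᵀ *ᵥ φ) ∈ E)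
    (f : (Fin 8 → ℝ) →ₗ[ℝ] (Fin 8 → ℂ)) (hf : ∀ s, T s = 0 → f s ∈ vecKer G E)
    (hf0 : ∀ s, f s = 0 → s = 0) : Module.finrank ℂ E ∈ ({8, 4, 2, 1} : Set ℕ) := by
  -- A non-null spinor makes `vecKer G E` trivial, so `T` is injective, hence onto, and all real
  -- vectors act.
  by_cases hψ : ∃ ψ ∈ E, ψ ⬝ᵥ ψ ≠ 0
  · obtain ⟨ψ, hψE, hψ⟩ := hψ
    have hinj : LinearMap.ker T = ⊥ := by
      rw [LinearMap.ker_eq_bot']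
      intro s hs
      exact hf0 s (eq_zero_of_slash_eq_zero G hψ (hf s hs ψ hψE))
    have hsurj := LinearMap.range_eq_top.1 (LinearMap.ker_eq_bot_iff_range_eq_top.1 hinj)
    rw [finrank_eq_eight_of_invariant G hψE hψ]
    · simp
    · intro s t φ hφ
      obtain ⟨s, rfl⟩ := hsurj s
      obtain ⟨t, rfl⟩ := hsurj t
      exact hE s t φ hφ
  · push Not at hψ
    -- Here isotropy refers to the bilinear form on the spinor space, which is again `ℂ⁸` with the
    -- dot product.
    have h4 := (isIsotropic_of_dotProduct_self hψ).finrank_le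
    have h0 : Module.finrank ℂ E ≠ 0 := fun h => hE0 (Submodule.finrank_eq_zero.1 h)
    -- The kernel of `T` has real dimension at most `2`, so its range has dimension at least `6`,
    -- more than the three needed for evenness.
    have h3 : Module.finrank ℂ E ≠ 3 := by
      intro h3
      have hv := finrank_vecKer_le_one G h3
      have hker : Module.finrank ℝ (LinearMap.ker T) ≤
          Module.finrank ℝ ((vecKer G E).restrictScalars ℝ) :=
        finrank_le_of_injOn f (fun s hs => hf s hs) (fun s _ h => hf0 s h)
      have h2 : Module.finrank ℝ ((vecKer G E).restrictScalars ℝ) =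
          2 * Module.finrank ℂ (vecKer G E) := finrank_real_of_complex (vecKer G E)
      have h8 := LinearMap.finrank_range_add_finrank_ker T
      rw [Module.finrank_fin_fun] at h8
      have heven := even_finrank_of_invariant G (R := LinearMap.range T) (E := E) (by omega) (by
        rintro _ ⟨s, rfl⟩ _ ⟨t, rfl⟩ φ hφ
        exact hE s t φ hφ)
      rw [h3] at heven
      exact absurd heven (by decide)
    have h5 : Module.finrank ℂ E = 1 ∨ Module.finrank ℂ E = 2 ∨ Module.finrank ℂ E = 4 := by omega
    rcases h5 with h | h | h <;> rw [h] <;> simp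

/-! ### The spin representation of `𝔰𝔬(8)` -/

/-- The action `¼ Q^{IJ} Γ^{IJ}` on chiral spinors. -/
noncomputable def spinRep (G : SpinEightGamma) (Q : Matrix (Fin 8) (Fin 8) ℝ) : Matrix (Fin 8) (Fin 8) ℝ :=
  (1 / 4 : ℝ) • ∑ I, ∑ J, Q I J • spinGamma G I J

/-- The action of `𝔰𝔬(8)` on anti-chiral spinors. -/
noncomputable def antiSpinRep (G : SpinEightGamma) (Q : Matrix (Fin 8) (Fin 8) ℝ) : Matrix (Fin 8) (Fin 8) ℝ :=
  -((1 / 4 : ℝ) • ∑ I, ∑ J, Q I J • ((G.mat I)ᵀ * G.mat J))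

theorem spinRep_transpose (G : SpinEightGamma) (Q : Matrix (Fin 8) (Fin 8) ℝ) :
    (spinRep G Q)ᵀ = -spinRep G Q := by
  simp only [spinRep, spinGamma, Matrix.transpose_smul, Matrix.transpose_sum, Matrix.transpose_neg,
    Matrix.transpose_sub, Matrix.transpose_mul, Matrix.transpose_transpose]
  rw [← smul_neg, ← Finset.sum_neg_distrib]
  congr 1
  refine Finset.sum_congr rfl fun I _ => ?_
  rw [← Finset.sum_neg_distrib]
  refine Finset.sum_congr rfl fun J _ => ?_
  rw [smul_neg, smul_neg, neg_neg, ← smul_neg, ← smul_neg, neg_sub]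

/-- Contraction with an antisymmetric `Q` makes the antisymmetrisation in `Γ^{IJ}` redundant. -/
theorem spinRep_eq (G : SpinEightGamma) {Q : Matrix (Fin 8) (Fin 8) ℝ} (hQ : Qᵀ = -Q) :
    spinRep G Q = -((1 / 4 : ℝ) • ∑ I, ∑ J, Q I J • (G.mat I * (G.mat J)ᵀ)) := by
  have hQ' : ∀ I J, Q J I = -Q I J := fun I J => congrFun (congrFun hQ I) J
  have h : ∑ I, ∑ J, Q I J • (G.mat J * (G.mat I)ᵀ) =
      -∑ I, ∑ J, Q I J • (G.mat I * (G.mat J)ᵀ) := by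
    rw [Finset.sum_comm, ← Finset.sum_neg_distrib]
    refine Finset.sum_congr rfl fun I _ => ?_
    rw [← Finset.sum_neg_distrib]
    refine Finset.sum_congr rfl fun J _ => ?_
    rw [hQ', neg_smul]
  have h2 : ∑ I, ∑ J, Q I J • spinGamma G I J =
      -((1 / 2 : ℝ) • (∑ I, ∑ J, Q I J • (G.mat I * (G.mat J)ᵀ) -
        ∑ I, ∑ J, Q I J • (G.mat J * (G.mat I)ᵀ))) := by
    simp only [spinGamma, smul_neg, Finset.sum_neg_distrib, ← Finset.sum_sub_distrib,
      Finset.smul_sum, smul_sub]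
    simp only [smul_comm (1 / 2 : ℝ)]
  rw [spinRep, h2, h, sub_neg_eq_add, ← two_smul ℝ, smul_smul, smul_neg]
  norm_num

theorem slash_single (G : SpinEightGamma) (I : Fin 8) :
    slash G (Pi.single I (1 : ℝ)) = G.mat I := by
  rw [slash, Finset.sum_eq_single I]
  · ext
    simp
  · intro J _ h
    rw [Pi.single_eq_of_ne h, zero_smul]
  · simp

theorem slash_real (G : SpinEightGamma) (s : Fin 8 → ℝ) : slash G s = ∑ I, s I • G.mat I := by
  refine Finset.sum_congr rfl fun I _ => ?_
  ext
  simp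

/-- Infinitesimal equivariance of Clifford multiplication, from moving `s` to the left through `Γ^I
Γ^J`; the two contraction terms add up by antisymmetry of `Q`. -/
theorem spinRep_mul_slash (G : SpinEightGamma) {Q : Matrix (Fin 8) (Fin 8) ℝ} (hQ : Qᵀ = -Q)
    (s : Fin 8 → ℝ) :
    spinRep G Q * slash G s = slash G s * antiSpinRep G Q - slash G (Q *ᵥ s) := by
  have h : ∀ I J, G.mat I * (G.mat J)ᵀ * slash G s = (2 * s J) • G.mat I - (2 * s I) • G.mat J +
      slash G s * ((G.mat I)ᵀ * G.mat J) := by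
    intro I J
    have h1 := transpose_slash_mul G (Pi.single J 1) s
    have h2 := slash_mul_transpose G (Pi.single I 1) s
    rw [slash_single, single_dotProduct, one_mul] at h1 h2
    have h3 : (G.mat J)ᵀ * slash G s = (2 * s J) • 1 - (slash G s)ᵀ * G.mat J :=
      eq_sub_of_add_eq h1
    have h4 : G.mat I * (slash G s)ᵀ = (2 * s I) • 1 - slash G s * (G.mat I)ᵀ :=
      eq_sub_of_add_eq h2
    rw [mul_assoc, h3, mul_sub, ← mul_assoc, h4, sub_mul, mul_assoc]
    simp only [mul_smul_comm, mul_one, smul_mul_assoc, one_mul]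
    abel
  have h1 : ∑ I, ∑ J, Q I J • ((2 * s J) • G.mat I) = (2 : ℝ) • slash G (Q *ᵥ s) := by
    simp only [slash_real, Matrix.mulVec, dotProduct, Finset.smul_sum, Finset.sum_smul, smul_smul]
    refine Finset.sum_congr rfl fun I _ => Finset.sum_congr rfl fun J _ => ?_
    congr 1
    ring
  have h2 : ∑ I, ∑ J, Q I J • ((2 * s I) • G.mat J) = -((2 : ℝ) • slash G (Q *ᵥ s)) := by
    have hQ' : ∀ I J, Q J I = -Q I J := fun I J => congrFun (congrFun hQ I) J
    rw [← h1, Finset.sum_comm, ← Finset.sum_neg_distrib]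
    refine Finset.sum_congr rfl fun I _ => ?_
    rw [← Finset.sum_neg_distrib]
    refine Finset.sum_congr rfl fun J _ => ?_
    rw [hQ', neg_smul]
  rw [spinRep_eq G hQ, antiSpinRep, neg_mul, smul_mul_assoc, Finset.sum_mul]
  simp only [Finset.sum_mul, smul_mul_assoc, h, smul_add, smul_sub, Finset.sum_add_distrib,
    Finset.sum_sub_distrib]
  rw [h1, h2, mul_neg, mul_smul_comm]
  simp only [Finset.mul_sum, mul_smul_comm]
  module

theorem antiSpinRep_transpose (G : SpinEightGamma) {Q : Matrix (Fin 8) (Fin 8) ℝ} (hQ : Qᵀ = -Q) :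
    (antiSpinRep G Q)ᵀ = -antiSpinRep G Q := by
  have hQ' : ∀ I J, Q J I = -Q I J := fun I J => congrFun (congrFun hQ I) J
  simp only [antiSpinRep, Matrix.transpose_smul, Matrix.transpose_sum, Matrix.transpose_neg,
    Matrix.transpose_mul, Matrix.transpose_transpose]
  rw [neg_inj, ← smul_neg, Finset.sum_comm, ← Finset.sum_neg_distrib]
  congr 1
  refine Finset.sum_congr rfl fun I _ => ?_
  rw [← Finset.sum_neg_distrib]
  refine Finset.sum_congr rfl fun J _ => ?_
  rw [hQ', neg_smul]

/-- This is the Leibniz rule in disguise: if `∂s = -Q s`, `∂t = -Q t` and `∂ε = S ε` with `S =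
spinRep G Q`, then `s t ε` obeys the same equation as `ε`. -/
theorem spinRep_mul_slash_mul_transpose (G : SpinEightGamma) {Q : Matrix (Fin 8) (Fin 8) ℝ}
    (hQ : Qᵀ = -Q) (s t : Fin 8 → ℝ) :
    spinRep G Q * (slash G s * (slash G t)ᵀ) = slash G s * (slash G t)ᵀ * spinRep G Q
      - slash G (Q *ᵥ s) * (slash G t)ᵀ - slash G s * (slash G (Q *ᵥ t))ᵀ := by
  have h := congrArg Matrix.transpose (spinRep_mul_slash G hQ t)
  rw [Matrix.transpose_sub, Matrix.transpose_mul, Matrix.transpose_mul, spinRep_transpose,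
    antiSpinRep_transpose G hQ, mul_neg, neg_mul] at h
  have h' : antiSpinRep G Q * (slash G t)ᵀ =
      (slash G t)ᵀ * spinRep G Q - (slash G (Q *ᵥ t))ᵀ := by
    rw [← neg_inj, neg_sub, ← neg_add_eq_sub]
    rw [eq_sub_iff_add_eq] at h
    rw [← h]
  rw [← mul_assoc, spinRep_mul_slash G hQ, sub_mul, mul_assoc, h', mul_sub, mul_assoc]
  abel

/-! ### Directional derivatives of matrix-valued functions -/

section MatDeriv

variable {m k l : Type*}

/-- `F` has the derivative `F'` at `p` along `X`, entry by entry. -/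
def HasMatDeriv (F : ℝ × ℂ → Matrix m k ℝ) (F' : Matrix m k ℝ) (p X : ℝ × ℂ) : Prop :=
  ∀ i j, HasLineDerivAt ℝ (fun q => F q i j) (F' i j) p X

variable {p X : ℝ × ℂ}

theorem HasMatDeriv.congr_deriv {F : ℝ × ℂ → Matrix m k ℝ} {F' F'' : Matrix m k ℝ}
    (h : HasMatDeriv F F' p X) (e : F' = F'') : HasMatDeriv F F'' p X := e ▸ h

theorem HasMatDeriv.unique {F : ℝ × ℂ → Matrix m k ℝ} {F' F'' : Matrix m k ℝ}
    (h : HasMatDeriv F F' p X) (h' : HasMatDeriv F F'' p X) : F' = F'' := by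
  ext i j
  exact HasLineDerivAt.unique (h i j) (h' i j)

theorem hasMatDeriv_const (C : Matrix m k ℝ) : HasMatDeriv (fun _ => C) 0 p X :=
  fun i j => hasDerivAt_const (0 : ℝ) (C i j)

theorem HasMatDeriv.transpose {F : ℝ × ℂ → Matrix m k ℝ} {F' : Matrix m k ℝ}
    (h : HasMatDeriv F F' p X) : HasMatDeriv (fun q => (F q)ᵀ) F'ᵀ p X :=
  fun i j => h j i

theorem HasMatDeriv.add {F H : ℝ × ℂ → Matrix m k ℝ} {F' H' : Matrix m k ℝ}
    (hF : HasMatDeriv F F' p X) (hH : HasMatDeriv H H' p X) :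
    HasMatDeriv (fun q => F q + H q) (F' + H') p X :=
  fun i j => HasDerivAt.fun_add (hF i j) (hH i j)

theorem HasMatDeriv.sum {ι : Type*} [Fintype ι] {F : ι → ℝ × ℂ → Matrix m k ℝ}
    {F' : ι → Matrix m k ℝ} (hF : ∀ a, HasMatDeriv (F a) (F' a) p X) :
    HasMatDeriv (fun q => ∑ a, F a q) (∑ a, F' a) p X := by
  intro i j
  simp only [Matrix.sum_apply]
  exact HasDerivAt.fun_sum fun a _ => hF a i j

theorem HasMatDeriv.mul [Fintype k] {F : ℝ × ℂ → Matrix m k ℝ} {H : ℝ × ℂ → Matrix k l ℝ}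
    {F' : Matrix m k ℝ} {H' : Matrix k l ℝ} (hF : HasMatDeriv F F' p X)
    (hH : HasMatDeriv H H' p X) :
    HasMatDeriv (fun q => F q * H q) (F' * H p + F p * H') p X := by
  intro i j
  simp only [Matrix.mul_apply, Matrix.add_apply, ← Finset.sum_add_distrib]
  refine HasDerivAt.fun_sum fun a _ => ?_
  have h := HasDerivAt.fun_mul (hF i a) (hH a j)
  simpa using h

theorem HasMatDeriv.hasLineDerivAt_trace [Fintype m] {F : ℝ × ℂ → Matrix m m ℝ}
    {F' : Matrix m m ℝ} (hF : HasMatDeriv F F' p X) :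
    HasLineDerivAt ℝ (fun q => (F q).trace) F'.trace p X :=
  HasDerivAt.fun_sum fun a _ => hF a a

theorem HasMatDeriv.slash (G : SpinEightGamma) {F : ℝ × ℂ → Matrix (Fin 8) k ℝ}
    {F' : Matrix (Fin 8) k ℝ} [Fintype k] (hF : HasMatDeriv F F' p X) (c : k → ℝ) :
    HasMatDeriv (fun q => slash G (F q *ᵥ c)) (TimelikeSugra.slash G (F' *ᵥ c)) p X := by
  intro i j
  simp only [slash_real, Matrix.sum_apply, Matrix.smul_apply, smul_eq_mul, Matrix.mulVec,
    dotProduct]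
  exact HasDerivAt.fun_sum fun I _ => HasDerivAt.mul_const
    (HasDerivAt.fun_sum fun a _ => HasDerivAt.mul_const (hF I a) (c a)) _

/-- Entrywise smoothness of a matrix-valued function. -/
def MatSmoothOn (F : ℝ × ℂ → Matrix m k ℝ) (s : Set (ℝ × ℂ)) : Prop :=
  ∀ i j, ContDiffOn ℝ ∞ (fun q => F q i j) s

variable {s : Set (ℝ × ℂ)}

theorem matSmoothOn_const (C : Matrix m k ℝ) : MatSmoothOn (fun _ => C) s :=
  fun _ _ => contDiffOn_const

theorem MatSmoothOn.transpose {F : ℝ × ℂ → Matrix m k ℝ} (h : MatSmoothOn F s) :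
    MatSmoothOn (fun q => (F q)ᵀ) s := fun i j => h j i

theorem MatSmoothOn.add {F H : ℝ × ℂ → Matrix m k ℝ} (hF : MatSmoothOn F s)
    (hH : MatSmoothOn H s) : MatSmoothOn (fun q => F q + H q) s :=
  fun i j => (hF i j).add (hH i j)

theorem MatSmoothOn.sum {ι : Type*} [Fintype ι] {F : ι → ℝ × ℂ → Matrix m k ℝ}
    (hF : ∀ a, MatSmoothOn (F a) s) : MatSmoothOn (fun q => ∑ a, F a q) s := by
  intro i j
  simp only [Matrix.sum_apply]
  exact ContDiffOn.sum fun a _ => hF a i j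

theorem MatSmoothOn.mul [Fintype k] {F : ℝ × ℂ → Matrix m k ℝ} {H : ℝ × ℂ → Matrix k l ℝ}
    (hF : MatSmoothOn F s) (hH : MatSmoothOn H s) : MatSmoothOn (fun q => F q * H q) s := by
  intro i j
  simp only [Matrix.mul_apply]
  exact ContDiffOn.sum fun a _ => (hF i a).mul (hH a j)

theorem MatSmoothOn.slash (G : SpinEightGamma) {F : ℝ × ℂ → Matrix (Fin 8) k ℝ} [Fintype k]
    (hF : MatSmoothOn F s) (c : k → ℝ) : MatSmoothOn (fun q => slash G (F q *ᵥ c)) s := by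
  intro i j
  simp only [slash_real, Matrix.sum_apply, Matrix.smul_apply, smul_eq_mul, Matrix.mulVec,
    dotProduct]
  exact ContDiffOn.sum fun I _ => (ContDiffOn.sum fun a _ =>
    (hF I a).mul contDiffOn_const).mul contDiffOn_const

end MatDeriv

/-! ### The dilatino equation for real vectors -/

theorem transpose_slash_real_mulVec (G : SpinEightGamma) (s ψ : Fin 8 → ℝ) (a : Fin 8) :
    ((slash G s)ᵀ *ᵥ ψ) a = ∑ I, ∑ A, s I * G.mat I A a * ψ A := by
  rw [slash_real, Matrix.transpose_sum, Matrix.sum_mulVec, Finset.sum_apply]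
  simp [Matrix.mulVec, dotProduct]

theorem dilatino_zero (G : SpinEightGamma) {n : ℕ} (Px Py : Matrix (Fin 8) (Fin n) ℝ)
    (ε : Spinor) (r : Fin n) (a : Fin 8) : dilatino G Px Py ε r 0 a =
      ((slash G (Px.col r))ᵀ *ᵥ ε 1 + (slash G (Py.col r))ᵀ *ᵥ ε 0) a := by
  rw [Pi.add_apply, transpose_slash_real_mulVec, transpose_slash_real_mulVec, dilatino,
    Fin.sum_univ_two, add_comm]
  simp [gammaOne, gammaTwo]

theorem dilatino_one (G : SpinEightGamma) {n : ℕ} (Px Py : Matrix (Fin 8) (Fin n) ℝ)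
    (ε : Spinor) (r : Fin n) (a : Fin 8) : dilatino G Px Py ε r 1 a =
      ((slash G (Px.col r))ᵀ *ᵥ ε 0 - (slash G (Py.col r))ᵀ *ᵥ ε 1) a := by
  rw [Pi.sub_apply, transpose_slash_real_mulVec, transpose_slash_real_mulVec, dilatino,
    Fin.sum_univ_two, sub_eq_add_neg]
  simp [gammaOne, gammaTwo]

/-- The pair of real vectors `(p, q)` satisfies the dilatino equation with the spinor `ε`. -/
def Annihilates (G : SpinEightGamma) (p q : Fin 8 → ℝ) (ε : Spinor) : Prop :=
  (slash G p)ᵀ *ᵥ ε 1 + (slash G q)ᵀ *ᵥ ε 0 = 0 ∧ (slash G p)ᵀ *ᵥ ε 0 - (slash G q)ᵀ *ᵥ ε 1 = 0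

theorem dilatino_eq_zero_iff_annihilates (G : SpinEightGamma) {n : ℕ}
    (Px Py : Matrix (Fin 8) (Fin n) ℝ) (ε : Spinor) (r : Fin n) :
    (∀ α a, dilatino G Px Py ε r α a = 0) ↔ Annihilates G (Px.col r) (Py.col r) ε := by
  rw [Fin.forall_fin_two]
  simp only [dilatino_zero, dilatino_one]
  exact and_congr funext_iff.symm funext_iff.symm

theorem annihilates_iff (G : SpinEightGamma) (p q : Fin 8 → ℝ) (ε : Spinor) :
    Annihilates G p q ε ↔
      (slash G (complexVec p - Complex.I • complexVec q))ᵀ *ᵥ spinorEquiv ε = 0 := by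
  have h := dilatino_eq_zero_iff_annihilates G (Matrix.of fun I (_ : Fin 1) => p I)
    (Matrix.of fun I (_ : Fin 1) => q I) ε 0
  rw [dilatino_eq_zero_iff] at h
  refine h.symm.trans ?_
  have e : (fun I => (1 / 2 : ℂ) * (((Matrix.of fun I (_ : Fin 1) => p I) I 0 : ℝ) -
      Complex.I * ((Matrix.of fun I (_ : Fin 1) => q I) I 0 : ℝ))) =
      (1 / 2 : ℂ) • (complexVec p - Complex.I • complexVec q) := by
    ext I
    simp [complexVec_apply]
  rw [e, slash_smul, Matrix.transpose_smul, Matrix.smul_mulVec]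
  simp

theorem dilatino_smul_left (G : SpinEightGamma) {n : ℕ} (Px Py : Matrix (Fin 8) (Fin n) ℝ)
    (c : ℝ) (ε : Spinor) (r : Fin n) (α : Fin 2) (a : Fin 8) :
    dilatino G (c • Px) (c • Py) ε r α a = c * dilatino G Px Py ε r α a := by
  simp only [dilatino, Matrix.smul_apply, smul_eq_mul, Finset.mul_sum]
  refine Finset.sum_congr rfl fun β _ => Finset.sum_congr rfl fun I _ =>
    Finset.sum_congr rfl fun A _ => by ring

/-- The sum of the squares of the components of a spinor. -/
def spinorNormSq (ε : Spinor) : ℝ := ε 0 ⬝ᵥ ε 0 + ε 1 ⬝ᵥ ε 1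

theorem spinorNormSq_eq_zero {ε : Spinor} (h : spinorNormSq ε = 0) : ε = 0 := by
  have h0 : 0 ≤ ε 0 ⬝ᵥ ε 0 := Finset.sum_nonneg fun _ _ => mul_self_nonneg _
  have h1 : 0 ≤ ε 1 ⬝ᵥ ε 1 := Finset.sum_nonneg fun _ _ => mul_self_nonneg _
  rw [spinorNormSq] at h
  have e0 : ε 0 = 0 := dotProduct_self_eq_zero.1 (by linarith)
  have e1 : ε 1 = 0 := dotProduct_self_eq_zero.1 (by linarith)
  ext α A
  fin_cases α
  · exact congrFun e0 A
  · exact congrFun e1 A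

theorem spinorNormSq_nonneg (ε : Spinor) : 0 ≤ spinorNormSq ε :=
  add_nonneg (Finset.sum_nonneg fun _ _ => mul_self_nonneg _)
    (Finset.sum_nonneg fun _ _ => mul_self_nonneg _)

/-! ### Spinors as matrices and their bilinears -/

/-- The `8 × 2` matrix of components of a spinor. -/
def spinorMatrix (ε : Spinor) : Matrix (Fin 8) (Fin 2) ℝ := Matrix.of fun A α => ε α A

/-- The complex structure `γ^1 γ^2` on spinors. -/
def gammaOneTwo : Matrix (Fin 2) (Fin 2) ℝ := gammaOne * gammaTwo

theorem gammaOneTwo_eq : gammaOneTwo = !![0, -1; 1, 0] := by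
  simp [gammaOneTwo, gammaOne, gammaTwo]

theorem gammaOneTwo_transpose : gammaOneTwoᵀ = -gammaOneTwo := by
  rw [gammaOneTwo_eq]
  ext i j
  fin_cases i <;> fin_cases j <;> simp

theorem trace_spinorMatrix (ε : Spinor) :
    ((spinorMatrix ε)ᵀ * spinorMatrix ε).trace = spinorNormSq ε := by
  simp [Matrix.trace, Fin.sum_univ_two, Matrix.mul_apply, spinorMatrix, spinorNormSq, dotProduct]

/-- The antisymmetric matrix `ε γ^1 γ^2 εᵀ`. -/
def spinorWedge (ε : Spinor) : Matrix (Fin 8) (Fin 8) ℝ :=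
  spinorMatrix ε * gammaOneTwo * (spinorMatrix ε)ᵀ

theorem spinorWedge_eq (ε : Spinor) :
    spinorWedge ε = Matrix.vecMulVec (ε 1) (ε 0) - Matrix.vecMulVec (ε 0) (ε 1) := by
  ext A B
  simp [spinorWedge, gammaOneTwo_eq, Matrix.mul_apply, Fin.sum_univ_two, spinorMatrix,
    Matrix.vecMulVec_apply]
  ring

theorem spinorWedge_transpose (ε : Spinor) : (spinorWedge ε)ᵀ = -spinorWedge ε := by
  rw [spinorWedge, Matrix.transpose_mul, Matrix.transpose_mul, Matrix.transpose_transpose,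
    gammaOneTwo_transpose, Matrix.neg_mul, Matrix.mul_neg, Matrix.mul_assoc]

/-- The two-form `tr (Γ^I Γ^Jᵀ S)`. -/
def twoForm (G : SpinEightGamma) (S : Matrix (Fin 8) (Fin 8) ℝ) : Matrix (Fin 8) (Fin 8) ℝ :=
  Matrix.of fun I J => (G.mat I * (G.mat J)ᵀ * S).trace

theorem twoForm_transpose (G : SpinEightGamma) {S : Matrix (Fin 8) (Fin 8) ℝ} (hS : Sᵀ = -S) :
    (twoForm G S)ᵀ = -twoForm G S := by
  ext I J
  rw [Matrix.transpose_apply, Matrix.neg_apply, twoForm, Matrix.of_apply, Matrix.of_apply,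
    ← Matrix.trace_transpose, Matrix.transpose_mul, hS, Matrix.transpose_mul,
    Matrix.transpose_transpose, Matrix.neg_mul, Matrix.trace_neg, Matrix.trace_mul_comm]

theorem trace_slash_mul (G : SpinEightGamma) (S : Matrix (Fin 8) (Fin 8) ℝ) (s t : Fin 8 → ℝ) :
    (slash G s * (slash G t)ᵀ * S).trace = s ⬝ᵥ (twoForm G S *ᵥ t) := by
  rw [slash_real, slash_real, Matrix.transpose_sum, Finset.sum_mul_sum, Finset.sum_mul,
    Matrix.trace_sum]
  simp only [dotProduct, Matrix.mulVec, Finset.mul_sum]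
  refine Finset.sum_congr rfl fun I _ => ?_
  rw [Finset.sum_mul, Matrix.trace_sum]
  refine Finset.sum_congr rfl fun J _ => ?_
  rw [Matrix.transpose_smul, smul_mul_smul_comm, Matrix.smul_mul, Matrix.trace_smul, twoForm,
    Matrix.of_apply, smul_eq_mul]
  ring

theorem trace_slash_mul_spinorWedge (G : SpinEightGamma) (ε : Spinor) (s t : Fin 8 → ℝ) :
    (slash G s * (slash G t)ᵀ * spinorWedge ε).trace =
      ((slash G s)ᵀ *ᵥ ε 0) ⬝ᵥ ((slash G t)ᵀ *ᵥ ε 1) -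
      ((slash G s)ᵀ *ᵥ ε 1) ⬝ᵥ ((slash G t)ᵀ *ᵥ ε 0) := by
  have h : ∀ x y : Fin 8 → ℝ, (slash G s * (slash G t)ᵀ * Matrix.vecMulVec x y).trace =
      ((slash G s)ᵀ *ᵥ y) ⬝ᵥ ((slash G t)ᵀ *ᵥ x) := by
    intro x y
    rw [Matrix.mul_vecMulVec, Matrix.trace_vecMulVec, ← Matrix.mulVec_mulVec, dotProduct_comm,
      Matrix.dotProduct_mulVec, ← Matrix.mulVec_transpose]
  rw [spinorWedge_eq, Matrix.mul_sub, Matrix.trace_sub, h, h]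

/-! ### The two-form of a finite family of spinors -/

section Family

variable {ι : Type*} [Fintype ι] (G : SpinEightGamma) (η : ι → Spinor)

/-- The two-form bilinear of a family of spinors. -/
def familyForm : Matrix (Fin 8) (Fin 8) ℝ := twoForm G (∑ i, spinorWedge (η i))

theorem familyForm_transpose : (familyForm G η)ᵀ = -familyForm G η := by
  refine twoForm_transpose G ?_
  rw [Matrix.transpose_sum, ← Finset.sum_neg_distrib]
  exact Finset.sum_congr rfl fun i _ => spinorWedge_transpose _

theorem dotProduct_familyForm (s t : Fin 8 → ℝ) : s ⬝ᵥ (familyForm G η *ᵥ t) =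
    ∑ i, (((slash G s)ᵀ *ᵥ η i 0) ⬝ᵥ ((slash G t)ᵀ *ᵥ η i 1) -
      ((slash G s)ᵀ *ᵥ η i 1) ⬝ᵥ ((slash G t)ᵀ *ᵥ η i 0)) := by
  rw [familyForm, ← trace_slash_mul, Finset.mul_sum, Matrix.trace_sum]
  exact Finset.sum_congr rfl fun i _ => trace_slash_mul_spinorWedge G (η i) s t

variable {G η}

theorem transpose_slash_dotProduct_real (s t ψ : Fin 8 → ℝ) :
    ((slash G s)ᵀ *ᵥ ψ) ⬝ᵥ ((slash G t)ᵀ *ᵥ ψ) = (s ⬝ᵥ t) * (ψ ⬝ᵥ ψ) := by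
  linear_combination (transpose_slash_dotProduct G s t ψ) / 2

/-- Substituting `p η_1 = -q η_0` and `p η_0 = q η_1` into the bilinear leaves `s·q` times the
squared norms, by the composition law. -/
theorem familyForm_mulVec_left {p q : Fin 8 → ℝ} (h : ∀ i, Annihilates G p q (η i)) :
    familyForm G η *ᵥ p = -((∑ i, spinorNormSq (η i)) • q) := by
  rw [← sub_eq_zero, sub_neg_eq_add]
  refine dotProduct_eq_zero _ fun s => ?_
  rw [dotProduct_comm, dotProduct_add, dotProduct_familyForm, dotProduct_smul, smul_eq_mul,
    Finset.sum_mul, ← Finset.sum_add_distrib]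
  refine Finset.sum_eq_zero fun i _ => ?_
  rw [eq_neg_of_add_eq_zero_left (h i).1, sub_eq_zero.1 (h i).2, dotProduct_neg,
    transpose_slash_dotProduct_real, transpose_slash_dotProduct_real, spinorNormSq]
  ring

theorem familyForm_mulVec_right {p q : Fin 8 → ℝ} (h : ∀ i, Annihilates G p q (η i)) :
    familyForm G η *ᵥ q = (∑ i, spinorNormSq (η i)) • p := by
  rw [← sub_eq_zero]
  refine dotProduct_eq_zero _ fun s => ?_
  rw [dotProduct_comm, dotProduct_sub, dotProduct_familyForm, dotProduct_smul, smul_eq_mul,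
    Finset.sum_mul, ← Finset.sum_sub_distrib]
  refine Finset.sum_eq_zero fun i _ => ?_
  rw [eq_neg_of_add_eq_zero_right (h i).1, ← sub_eq_zero.1 (h i).2, dotProduct_neg,
    transpose_slash_dotProduct_real, transpose_slash_dotProduct_real, spinorNormSq]
  ring

/-- With `l` the total squared norm and `b` the two-form, the squared lengths of all dilatino
components sum to `l (|p|² + |q|²) - 2 b(p, q)`. The hypothesis is the equality case, so each square
vanishes. -/
theorem annihilates_of_familyForm {p q : Fin 8 → ℝ}
    (h : (∑ i, spinorNormSq (η i)) * (p ⬝ᵥ p + q ⬝ᵥ q) = 2 * (p ⬝ᵥ (familyForm G η *ᵥ q)))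
    (i : ι) : Annihilates G p q (η i) := by
  have h1 : ∑ i, ((((slash G p)ᵀ *ᵥ η i 1 + (slash G q)ᵀ *ᵥ η i 0) ⬝ᵥ
      ((slash G p)ᵀ *ᵥ η i 1 + (slash G q)ᵀ *ᵥ η i 0)) +
      (((slash G p)ᵀ *ᵥ η i 0 - (slash G q)ᵀ *ᵥ η i 1) ⬝ᵥ
      ((slash G p)ᵀ *ᵥ η i 0 - (slash G q)ᵀ *ᵥ η i 1))) = 0 := by
    rw [dotProduct_familyForm, Finset.sum_mul, Finset.mul_sum] at h
    rw [← sub_eq_zero, ← Finset.sum_sub_distrib] at h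
    rw [← h]
    refine Finset.sum_congr rfl fun i _ => ?_
    simp only [add_dotProduct, dotProduct_add, sub_dotProduct, dotProduct_sub,
      transpose_slash_dotProduct_real, spinorNormSq]
    rw [dotProduct_comm ((slash G q)ᵀ *ᵥ η i 0), dotProduct_comm ((slash G q)ᵀ *ᵥ η i 1)]
    ring
  have hnn : ∀ x : Fin 8 → ℝ, 0 ≤ x ⬝ᵥ x := fun x => Finset.sum_nonneg fun _ _ => mul_self_nonneg _
  have h2 := (Finset.sum_eq_zero_iff_of_nonneg
    (fun i _ => add_nonneg (hnn _) (hnn _))).1 h1 i (Finset.mem_univ i)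
  have h3 := (add_eq_zero_iff_of_nonneg (hnn _) (hnn _)).1 h2
  exact ⟨dotProduct_self_eq_zero.1 h3.1, dotProduct_self_eq_zero.1 h3.2⟩

end Family

/-- A vector orthogonal to `s` and `t` anticommutes with each, hence commutes with the product `s
t`. -/
theorem Annihilates.slash_mul {G : SpinEightGamma} {p q s t : Fin 8 → ℝ} {ε ε' : Spinor}
    (h : Annihilates G p q ε) (hps : p ⬝ᵥ s = 0) (hqs : q ⬝ᵥ s = 0) (hpt : p ⬝ᵥ t = 0)
    (hqt : q ⬝ᵥ t = 0) (hε : ∀ α, ε' α = slash G s *ᵥ ((slash G t)ᵀ *ᵥ ε α)) :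
    Annihilates G p q ε' := by
  have key : ∀ (x ψ : Fin 8 → ℝ), x ⬝ᵥ s = 0 → x ⬝ᵥ t = 0 →
      (slash G x)ᵀ *ᵥ (slash G s *ᵥ ((slash G t)ᵀ *ᵥ ψ)) =
        (slash G s)ᵀ *ᵥ (slash G t *ᵥ ((slash G x)ᵀ *ᵥ ψ)) := by
    intro x ψ hs ht
    rw [transpose_slash_mulVec, hs, slash_mulVec_transpose G x t, ht]
    simp [Matrix.mulVec_neg]
  constructor
  · rw [hε, hε, key p _ hps hpt, key q _ hqs hqt, ← Matrix.mulVec_add, ← Matrix.mulVec_add, h.1]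
    simp
  · rw [hε, hε, key p _ hps hpt, key q _ hqs hqt, ← Matrix.mulVec_sub, ← Matrix.mulVec_sub, h.2]
    simp

namespace TimelikeBackground

variable {n : ℕ} (B : TimelikeBackground n)

/-! ### The Maurer-Cartan form -/

theorem isUnit_V_det {z : ℂ} (hz : z ∈ B.dom) : IsUnit (B.V z).det := by
  rw [B.V_det z hz]
  exact isUnit_one

theorem hasLineDerivAt_of_fst {f : ℂ → ℝ} {p : ℝ × ℂ} (hf : DifferentiableAt ℝ f p.2)
    (X : ℝ × ℂ) : HasLineDerivAt ℝ (fun q : ℝ × ℂ => f q.2) (fderiv ℝ f p.2 X.2) p X :=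
  (HasFDerivAt.comp p hf.hasFDerivAt hasFDerivAt_snd).hasLineDerivAt X

theorem hasMatDeriv_V {p : ℝ × ℂ} (hp : p.2 ∈ B.dom) (X : ℝ × ℂ) :
    HasMatDeriv (fun q => B.V q.2) (B.V p.2 * maurerCartan B.V p.2 X.2) p X := by
  rw [maurerCartan, ← mul_assoc, Matrix.mul_nonsing_inv _ (B.isUnit_V_det hp), one_mul]
  intro a b
  exact hasLineDerivAt_of_fst (f := fun w => B.V w a b) (((B.smooth_V a b).contDiffAt
    (B.isOpen_dom.mem_nhds hp)).differentiableAt (by simp)) X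

theorem eventually_mem_dom {p : ℝ × ℂ} (hp : p.2 ∈ B.dom) : ∀ᶠ q in nhds p, q.2 ∈ B.dom :=
  continuous_snd.continuousAt.eventually (B.isOpen_dom.mem_nhds hp)

/-- Differentiate `𝒱ᵀ η 𝒱 = η`. -/
theorem maurerCartan_antisymm {z : ℂ} (hz : z ∈ B.dom) (v : ℂ) :
    (maurerCartan B.V z v)ᵀ * etaForm n + etaForm n * maurerCartan B.V z v = 0 := by
  set A := maurerCartan B.V z v with hA
  have hV := B.hasMatDeriv_V (p := (0, z)) hz (0, v)
  have h1 := (hV.transpose.mul (hasMatDeriv_const (etaForm n))).mul hV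
  have h2 : HasMatDeriv (fun q : ℝ × ℂ => (B.V q.2)ᵀ * etaForm n * B.V q.2) 0 (0, z) (0, v) := by
    intro i j
    refine HasLineDerivAt.congr_of_eventuallyEq (hasMatDeriv_const (etaForm n) i j) ?_
    filter_upwards [B.eventually_mem_dom (p := (0, z)) hz] with q hq
    rw [B.V_orthogonal _ hq]
  have h3 := h1.unique h2
  simp only [← hA, mul_zero, add_zero, Matrix.transpose_mul] at h3
  rw [Matrix.mul_assoc Aᵀ, Matrix.mul_assoc Aᵀ, B.V_orthogonal z hz, ← Matrix.mul_assoc,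
    B.V_orthogonal z hz] at h3
  exact h3

theorem maurerCartan_eq_fromBlocks (z v : ℂ) : maurerCartan B.V z v =
    Matrix.fromBlocks (connEight B.V z v) (currentP B.V z v) (maurerCartan B.V z v).toBlocks₂₁
      (connN B.V z v) := (Matrix.fromBlocks_toBlocks _).symm

theorem maurerCartan_blocks {z : ℂ} (hz : z ∈ B.dom) (v : ℂ) :
    (connEight B.V z v)ᵀ = -connEight B.V z v ∧
      (maurerCartan B.V z v).toBlocks₂₁ = (currentP B.V z v)ᵀ := by
  have h := B.maurerCartan_antisymm hz v
  rw [maurerCartan_eq_fromBlocks, etaForm, Matrix.fromBlocks_transpose, Matrix.fromBlocks_multiply,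
    Matrix.fromBlocks_multiply, Matrix.fromBlocks_add, ← Matrix.fromBlocks_zero,
    Matrix.fromBlocks_inj] at h
  simp only [Matrix.mul_one, Matrix.mul_zero, Matrix.one_mul, Matrix.zero_mul, Matrix.mul_neg,
    Matrix.neg_mul, add_zero, zero_add] at h
  exact ⟨eq_neg_of_add_eq_zero_left h.1, (sub_eq_zero.1 (by
    rw [sub_eq_add_neg]; exact h.2.2.1)).symm⟩

theorem connEight_transpose {z : ℂ} (hz : z ∈ B.dom) (v : ℂ) :
    (connEight B.V z v)ᵀ = -connEight B.V z v := (B.maurerCartan_blocks hz v).1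

/-- The first eight columns of the coset representative, transposed. -/
def frame (z : ℂ) : Matrix (Fin 8) (Fin 8 ⊕ Fin n) ℝ := ((B.V z).submatrix id Sum.inl)ᵀ

/-- The first eight columns of `d𝒱 = 𝒱 (Q + P)`. The covariant derivative of the frame is
proportional to `P`, so a covariantly constant operator that kills `P` turns the frame into parallel
vectors. -/
theorem hasMatDeriv_frame {p : ℝ × ℂ} (hp : p.2 ∈ B.dom) (X : ℝ × ℂ) :
    HasMatDeriv (fun q => B.frame q.2) (-(connEight B.V p.2 X.2 * B.frame p.2) +
      currentP B.V p.2 X.2 * ((B.V p.2).submatrix id Sum.inr)ᵀ) p X := by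
  have h : HasMatDeriv (fun q => B.frame q.2)
      ((B.V p.2 * maurerCartan B.V p.2 X.2).submatrix id Sum.inl)ᵀ p X :=
    fun i j => B.hasMatDeriv_V hp X j (Sum.inl i)
  refine h.congr_deriv ?_
  obtain ⟨h1, h2⟩ := B.maurerCartan_blocks hp X.2
  rw [← Matrix.neg_mul, ← h1, ← Matrix.transpose_transpose (currentP B.V p.2 X.2), ← h2, frame,
    ← Matrix.transpose_mul, ← Matrix.transpose_mul, ← Matrix.transpose_add]
  congr 1
  ext i j
  simp [Matrix.mul_apply, connEight, Matrix.toBlocks₁₁, Matrix.toBlocks₂₁]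

/-- Invertibility of `𝒱`: every vector at a point comes from a constant `c`, so parallel fields
realise the whole range of the operator. -/
theorem frame_mulVec_surjective {z : ℂ} (hz : z ∈ B.dom) (s : Fin 8 → ℝ) :
    ∃ c : Fin 8 ⊕ Fin n → ℝ, B.frame z *ᵥ c = s := by
  have hdet : IsUnit (B.V z)ᵀ.det := by
    rw [Matrix.det_transpose]
    exact B.isUnit_V_det hz
  refine ⟨(B.V z)ᵀ⁻¹ *ᵥ Sum.elim s 0, ?_⟩
  have h : (B.V z)ᵀ *ᵥ ((B.V z)ᵀ⁻¹ *ᵥ Sum.elim s 0) = Sum.elim s 0 := by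
    rw [Matrix.mulVec_mulVec, Matrix.mul_nonsing_inv _ hdet, Matrix.one_mulVec]
  ext I
  exact congrFun h (Sum.inl I)

/-! ### Killing spinors -/

variable {B} {G : SpinEightGamma}

theorem gravitino_apply (G : SpinEightGamma) (ε : ℝ × ℂ → Spinor) (p : ℝ × ℂ) (v : ℂ) (α : Fin 2)
    (A : Fin 8) : B.gravitino G ε p v α A = fderiv ℝ ε p (0, v) α A -
      (spinRep G (connEight B.V p.2 v) * spinorMatrix (ε p) +
        (1 / 2 * B.spinConn p.2 v) • (spinorMatrix (ε p) * gammaOneTwoᵀ)) A α := by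
  have h1 : (spinRep G (connEight B.V p.2 v) * spinorMatrix (ε p)) A α =
      1 / 4 * ∑ I, ∑ J, ∑ C, connEight B.V p.2 v I J * spinGamma G I J A C * ε p α C := by
    rw [spinRep, Matrix.smul_mul, Matrix.smul_apply, smul_eq_mul, Matrix.sum_mul, Matrix.sum_apply]
    congr 1
    refine Finset.sum_congr rfl fun I _ => ?_
    rw [Matrix.sum_mul, Matrix.sum_apply]
    refine Finset.sum_congr rfl fun J _ => ?_
    simp [Matrix.mul_apply, spinorMatrix]
  have h2 : ((1 / 2 * B.spinConn p.2 v) • (spinorMatrix (ε p) * gammaOneTwoᵀ)) A α =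
      1 / 2 * B.spinConn p.2 v * ∑ β, (gammaOne * gammaTwo) α β * ε p β A := by
    rw [Matrix.smul_apply, smul_eq_mul, Matrix.mul_apply]
    congr 1
    refine Finset.sum_congr rfl fun β _ => ?_
    simp [spinorMatrix, gammaOneTwo, mul_comm]
  rw [Matrix.add_apply, h1, h2, gravitino]
  ring

theorem fderiv_spinor_apply {ε : ℝ × ℂ → Spinor} {p : ℝ × ℂ} (h : DifferentiableAt ℝ ε p)
    (X : ℝ × ℂ) (α : Fin 2) (A : Fin 8) :
    HasLineDerivAt ℝ (fun q => ε q α A) (fderiv ℝ ε p X α A) p X :=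
  (hasFDerivAt_pi'.1 (hasFDerivAt_pi'.1 h.hasFDerivAt α) A).hasLineDerivAt X

/-- The derivative of a Killing spinor along `X`. -/
theorem IsKilling.hasMatDeriv {ε : ℝ × ℂ → Spinor} (h : B.IsKilling G ε) {p : ℝ × ℂ}
    (hp : p.2 ∈ B.dom) (X : ℝ × ℂ) : HasMatDeriv (fun q => spinorMatrix (ε q))
      (spinRep G (connEight B.V p.2 X.2) * spinorMatrix (ε p) +
        (1 / 2 * B.spinConn p.2 X.2) • (spinorMatrix (ε p) * gammaOneTwoᵀ)) p X := by
  intro A α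
  have h1 := fderiv_spinor_apply (h.differentiableAt hp) X α A
  have hX : X = X.1 • ((1, 0) : ℝ × ℂ) + (0, X.2) := by ext <;> simp
  have h2 := congrFun (congrFun (h.gravitino_eq p hp X.2) α) A
  rw [gravitino_apply, Pi.zero_apply, Pi.zero_apply, sub_eq_zero] at h2
  rw [← h2]
  have h3 : fderiv ℝ ε p X = fderiv ℝ ε p (0, X.2) := by
    conv_lhs => rw [hX]
    rw [map_add, map_smul, h.time_eq p hp, smul_zero, zero_add]
  rw [← h3]
  exact h1

theorem IsKilling.matSmoothOn {ε : ℝ × ℂ → Spinor} (h : B.IsKilling G ε) :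
    MatSmoothOn (fun q => spinorMatrix (ε q)) (Set.univ ×ˢ B.dom) :=
  fun A α => contDiffOn_pi.1 (contDiffOn_pi.1 h.smooth α) A

theorem IsKilling.annihilates {ε : ℝ × ℂ → Spinor} (h : B.IsKilling G ε) {p : ℝ × ℂ}
    (hp : p.2 ∈ B.dom) (r : Fin n) : Annihilates G ((currentP B.V p.2 1).col r)
      ((currentP B.V p.2 Complex.I).col r) (ε p) := by
  rw [← dilatino_eq_zero_iff_annihilates]
  intro α a
  have h1 := h.dilatino_eq p hp r α a
  rw [dilatino_smul_left] at h1
  exact (mul_eq_zero.1 h1).resolve_left (Real.exp_ne_zero _)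

theorem isKilling_of {ε : ℝ × ℂ → Spinor}
    (hs : MatSmoothOn (fun q => spinorMatrix (ε q)) (Set.univ ×ˢ B.dom))
    (h0 : ∀ p : ℝ × ℂ, p.2 ∉ B.dom → ε p = 0)
    (hd : ∀ p : ℝ × ℂ, p.2 ∈ B.dom → ∀ X, HasMatDeriv (fun q => spinorMatrix (ε q))
      (spinRep G (connEight B.V p.2 X.2) * spinorMatrix (ε p) +
        (1 / 2 * B.spinConn p.2 X.2) • (spinorMatrix (ε p) * gammaOneTwoᵀ)) p X)
    (ha : ∀ p : ℝ × ℂ, p.2 ∈ B.dom → ∀ r, Annihilates G ((currentP B.V p.2 1).col r)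
      ((currentP B.V p.2 Complex.I).col r) (ε p)) : B.IsKilling G ε := by
  have hsm : ContDiffOn ℝ ∞ ε (Set.univ ×ˢ B.dom) :=
    contDiffOn_pi.2 fun α => contDiffOn_pi.2 fun A => hs A α
  have hdiff : ∀ p : ℝ × ℂ, p.2 ∈ B.dom → DifferentiableAt ℝ ε p := fun p hp =>
    (hsm.contDiffAt ((isOpen_univ.prod B.isOpen_dom).mem_nhds ⟨Set.mem_univ _, hp⟩)
      ).differentiableAt (by simp)
  have hf : ∀ p : ℝ × ℂ, p.2 ∈ B.dom → ∀ X α A, fderiv ℝ ε p X α A =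
      (spinRep G (connEight B.V p.2 X.2) * spinorMatrix (ε p) +
        (1 / 2 * B.spinConn p.2 X.2) • (spinorMatrix (ε p) * gammaOneTwoᵀ)) A α :=
    fun p hp X α A => (fderiv_spinor_apply (hdiff p hp) X α A).unique (hd p hp X A α)
  refine ⟨hsm, h0, ?_, ?_, ?_⟩
  · intro p hp
    ext α A
    rw [hf p hp]
    have h1 : connEight B.V p.2 0 = 0 := by
      ext I J
      simp [connEight, maurerCartan, Matrix.toBlocks₁₁, Matrix.mul_apply]
    have h2 : B.spinConn p.2 0 = 0 := by simp [spinConn]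
    simp [h1, h2, spinRep]
  · intro p hp v
    ext α A
    rw [gravitino_apply, hf p hp, sub_self]
    rfl
  · intro p hp r α a
    rw [dilatino_smul_left, (dilatino_eq_zero_iff_annihilates G _ _ _ _).2 (ha p hp r), mul_zero]

/-- The norm of a Killing spinor is constant. -/
theorem IsKilling.spinorNormSq_eq {ε : ℝ × ℂ → Spinor} (h : B.IsKilling G ε) {p q : ℝ × ℂ}
    (hp : p.2 ∈ B.dom) (hq : q.2 ∈ B.dom) : spinorNormSq (ε p) = spinorNormSq (ε q) := by
  have hopen : IsOpen ((Set.univ : Set ℝ) ×ˢ B.dom) := isOpen_univ.prod B.isOpen_dom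
  have hconn : IsPreconnected ((Set.univ : Set ℝ) ×ˢ B.dom) :=
    isPreconnected_univ.prod B.isConnected_dom.isPreconnected
  have hdiff : ∀ x ∈ (Set.univ : Set ℝ) ×ˢ B.dom,
      DifferentiableAt ℝ (fun q => ((spinorMatrix (ε q))ᵀ * spinorMatrix (ε q)).trace) x := by
    intro x hx
    have hsm : ContDiffOn ℝ ∞ (fun q => ((spinorMatrix (ε q))ᵀ * spinorMatrix (ε q)).trace)
        ((Set.univ : Set ℝ) ×ˢ B.dom) :=
      ContDiffOn.sum fun a _ => h.matSmoothOn.transpose.mul h.matSmoothOn a a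
    exact (hsm.contDiffAt (hopen.mem_nhds hx)).differentiableAt (by simp)
  rw [← trace_spinorMatrix, ← trace_spinorMatrix]
  refine hopen.is_const_of_fderiv_eq_zero (𝕜 := ℝ) hconn
    (f := fun q => ((spinorMatrix (ε q))ᵀ * spinorMatrix (ε q)).trace)
    (fun x hx => (hdiff x hx).differentiableWithinAt) ?_ ⟨Set.mem_univ _, hp⟩ ⟨Set.mem_univ _, hq⟩
  intro x hx
  refine ContinuousLinearMap.ext fun X => ?_
  have h1 := (h.hasMatDeriv hx.2 X).transpose.mul (h.hasMatDeriv hx.2 X)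
  have h2 := h1.hasLineDerivAt_trace
  have h3 := ((hdiff x hx).hasFDerivAt.hasLineDerivAt X).unique h2
  rw [h3]
  set Ψ := spinorMatrix (ε x)
  set S := spinRep G (connEight B.V x.2 X.2)
  set w := 1 / 2 * B.spinConn x.2 X.2
  -- Both connection terms are antisymmetric, so their contributions to the derivative of the norm
  -- cancel in pairs.
  have hST : Sᵀ = -S := spinRep_transpose _ _
  rw [Matrix.transpose_add, Matrix.transpose_mul, hST, Matrix.transpose_smul,
    Matrix.transpose_mul, Matrix.transpose_transpose, gammaOneTwo_transpose, Matrix.add_mul,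
    Matrix.mul_add, Matrix.trace_add, Matrix.trace_add, Matrix.trace_add, Matrix.mul_neg,
    Matrix.neg_mul, Matrix.trace_neg, Matrix.mul_assoc, Matrix.smul_mul, Matrix.mul_smul,
    Matrix.mul_neg, Matrix.mul_neg, Matrix.trace_smul, Matrix.trace_smul, Matrix.trace_neg,
    Matrix.mul_assoc, Matrix.trace_mul_comm gammaOneTwo, Matrix.mul_assoc]
  simp
  ring

/-! ### Bilinears of Killing spinors -/

/-- The spin connection acts by multiples of `γ^1 γ^2`, which preserve `ε γ^1 γ^2 εᵀ`; only the
`𝔰𝔬(8)` commutator survives. -/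
theorem IsKilling.hasMatDeriv_spinorWedge {ε : ℝ × ℂ → Spinor} (h : B.IsKilling G ε) {p : ℝ × ℂ}
    (hp : p.2 ∈ B.dom) (X : ℝ × ℂ) : HasMatDeriv (fun q => spinorWedge (ε q))
      (spinRep G (connEight B.V p.2 X.2) * spinorWedge (ε p) -
        spinorWedge (ε p) * spinRep G (connEight B.V p.2 X.2)) p X := by
  have h1 := ((h.hasMatDeriv hp X).mul (hasMatDeriv_const gammaOneTwo)).mul
    (h.hasMatDeriv hp X).transpose
  refine h1.congr_deriv ?_
  set Ψ := spinorMatrix (ε p) with hΨ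
  set S := spinRep G (connEight B.V p.2 X.2)
  set w := 1 / 2 * B.spinConn p.2 X.2
  have hST : Sᵀ = -S := spinRep_transpose _ _
  rw [Matrix.mul_zero, add_zero, Matrix.transpose_add, Matrix.transpose_mul, hST,
    Matrix.transpose_smul, Matrix.transpose_mul, Matrix.transpose_transpose, gammaOneTwo_transpose,
    spinorWedge, ← hΨ]
  simp only [Matrix.add_mul, Matrix.mul_add, Matrix.mul_neg, Matrix.neg_mul, Matrix.smul_mul,
    Matrix.mul_smul, Matrix.mul_assoc, smul_neg]
  abel

/-- Equivariance of Clifford multiplication under the trace carries the spinor commutator to the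
vector one: the two-form of a covariantly constant `S` is covariantly constant. -/
theorem hasMatDeriv_twoForm {S : ℝ × ℂ → Matrix (Fin 8) (Fin 8) ℝ}
    {Q : Matrix (Fin 8) (Fin 8) ℝ} (hQ : Qᵀ = -Q) {p X : ℝ × ℂ}
    (hS : HasMatDeriv S (spinRep G Q * S p - S p * spinRep G Q) p X) :
    HasMatDeriv (fun q => twoForm G (S q)) (twoForm G (S p) * Q - Q * twoForm G (S p)) p X := by
  intro I J
  have h1 := ((hasMatDeriv_const (G.mat I * (G.mat J)ᵀ)).mul hS).hasLineDerivAt_trace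
  suffices h : (twoForm G (S p) * Q - Q * twoForm G (S p)) I J = (0 * S p +
      G.mat I * (G.mat J)ᵀ * (spinRep G Q * S p - S p * spinRep G Q)).trace by
    rw [h]
    exact h1
  have hcomm := spinRep_mul_slash_mul_transpose G hQ (Pi.single I 1) (Pi.single J 1)
  have e1 : (G.mat I * (G.mat J)ᵀ * (spinRep G Q * S p - S p * spinRep G Q)).trace =
      ((G.mat I * (G.mat J)ᵀ * spinRep G Q - spinRep G Q * (G.mat I * (G.mat J)ᵀ)) *
        S p).trace := by
    rw [Matrix.mul_sub, Matrix.sub_mul, Matrix.trace_sub, Matrix.trace_sub, ← Matrix.mul_assoc,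
      ← Matrix.mul_assoc, Matrix.trace_mul_comm _ (spinRep G Q), Matrix.mul_assoc (spinRep G Q)]
  rw [slash_single, slash_single] at hcomm
  have e2 : G.mat I * (G.mat J)ᵀ * spinRep G Q - spinRep G Q * (G.mat I * (G.mat J)ᵀ) =
      slash G (Q *ᵥ Pi.single I 1) * (slash G (Pi.single J 1))ᵀ +
      slash G (Pi.single I 1) * (slash G (Q *ᵥ Pi.single J 1))ᵀ := by
    rw [hcomm, slash_single, slash_single]
    abel
  rw [Matrix.zero_mul, zero_add, e1, e2, Matrix.add_mul, Matrix.trace_add, trace_slash_mul,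
    trace_slash_mul, Matrix.sub_apply, Matrix.mul_apply, Matrix.mul_apply, add_comm, sub_eq_add_neg,
    ← Finset.sum_neg_distrib]
  have hQ' : ∀ I J, Q J I = -Q I J := fun I J => congrFun (congrFun hQ I) J
  congr 1
  · rw [single_dotProduct, one_mul, Matrix.mulVec_single_one]
    rfl
  · simp only [Matrix.mulVec_single_one, dotProduct]
    refine Finset.sum_congr rfl fun K _ => ?_
    rw [Matrix.col_apply, Matrix.col_apply, hQ' I K, neg_mul]

/-! ### Parallel vectors and the Clifford symmetries of Killing spinors -/

section Family

variable {ι : Type*} [Fintype ι] {e : ι → ℝ × ℂ → Spinor}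

theorem hasMatDeriv_familyForm (he : ∀ i, B.IsKilling G (e i)) {p : ℝ × ℂ} (hp : p.2 ∈ B.dom)
    (X : ℝ × ℂ) : HasMatDeriv (fun q => familyForm G fun i => e i q)
      ((familyForm G fun i => e i p) * connEight B.V p.2 X.2 -
        connEight B.V p.2 X.2 * familyForm G fun i => e i p) p X := by
  refine hasMatDeriv_twoForm (S := fun q => ∑ i, spinorWedge (e i q))
    (B.connEight_transpose hp X.2) ?_
  refine (HasMatDeriv.sum fun i => (he i).hasMatDeriv_spinorWedge hp X).congr_deriv ?_
  rw [Finset.sum_sub_distrib, Finset.mul_sum, Finset.sum_mul]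

/-- The operator `l² + b²`, where `b` is the two-form of a family of spinors. -/
def familyOp (G : SpinEightGamma) (e : ι → ℝ × ℂ → Spinor) (l : ℝ) (p : ℝ × ℂ) :
    Matrix (Fin 8) (Fin 8) ℝ :=
  (l ^ 2) • 1 + (familyForm G fun i => e i p) * familyForm G fun i => e i p

theorem familyOp_transpose (l : ℝ) (p : ℝ × ℂ) : (familyOp G e l p)ᵀ = familyOp G e l p := by
  rw [familyOp, Matrix.transpose_add, Matrix.transpose_mul, familyForm_transpose, Matrix.mul_neg,
    Matrix.neg_mul, neg_neg, Matrix.transpose_smul, Matrix.transpose_one]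

theorem hasMatDeriv_familyOp (he : ∀ i, B.IsKilling G (e i)) (l : ℝ) {p : ℝ × ℂ}
    (hp : p.2 ∈ B.dom) (X : ℝ × ℂ) : HasMatDeriv (familyOp G e l)
      (familyOp G e l p * connEight B.V p.2 X.2 - connEight B.V p.2 X.2 * familyOp G e l p)
      p X := by
  have h := hasMatDeriv_familyForm he hp X
  refine ((hasMatDeriv_const ((l ^ 2) • (1 : Matrix (Fin 8) (Fin 8) ℝ))).add
    (h.mul h)).congr_deriv ?_
  rw [familyOp]
  simp only [add_mul, mul_add, sub_mul, mul_sub, zero_add, smul_mul_assoc, mul_smul_comm, one_mul,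
    mul_one, mul_assoc]
  abel

/-- The operator annihilates the scalar current. -/
theorem familyOp_mulVec_currentP (he : ∀ i, B.IsKilling G (e i)) {l : ℝ}
    (hl : ∀ q : ℝ × ℂ, q.2 ∈ B.dom → ∑ i, spinorNormSq (e i q) = l) {p : ℝ × ℂ}
    (hp : p.2 ∈ B.dom) (r : Fin n) :
    familyOp G e l p *ᵥ (currentP B.V p.2 1).col r = 0 ∧
      familyOp G e l p *ᵥ (currentP B.V p.2 Complex.I).col r = 0 := by
  have h1 := familyForm_mulVec_left fun i => (he i).annihilates hp r
  have h2 := familyForm_mulVec_right fun i => (he i).annihilates hp r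
  rw [hl p hp] at h1 h2
  constructor
  · rw [familyOp, Matrix.add_mulVec, Matrix.smul_mulVec, Matrix.one_mulVec, ← Matrix.mulVec_mulVec,
      h1, Matrix.mulVec_neg, Matrix.mulVec_smul, h2, smul_smul, sq, add_neg_cancel]
  · rw [familyOp, Matrix.add_mulVec, Matrix.smul_mulVec, Matrix.one_mulVec, ← Matrix.mulVec_mulVec,
      h2, Matrix.mulVec_smul, h1, smul_neg, smul_smul, sq, add_neg_cancel]

theorem currentP_eq (B : TimelikeBackground n) (z v : ℂ) :
    currentP B.V z v = v.re • currentP B.V z 1 + v.im • currentP B.V z Complex.I := by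
  have h : maurerCartan B.V z v = v.re • maurerCartan B.V z 1 +
      v.im • maurerCartan B.V z Complex.I := by
    simp only [maurerCartan]
    rw [← Matrix.mul_smul, ← Matrix.mul_smul, ← Matrix.mul_add]
    congr 1
    ext a b
    have hv : v = v.re • (1 : ℂ) + v.im • Complex.I := by
      simp [Complex.re_add_im]
    conv_lhs => rw [hv]
    simp only [Matrix.of_apply, Matrix.add_apply, Matrix.smul_apply, map_add, map_smul]
  rw [currentP, h]
  rfl

theorem familyOp_mul_currentP (he : ∀ i, B.IsKilling G (e i)) {l : ℝ}
    (hl : ∀ q : ℝ × ℂ, q.2 ∈ B.dom → ∑ i, spinorNormSq (e i q) = l) {p : ℝ × ℂ}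
    (hp : p.2 ∈ B.dom) (v : ℂ) : familyOp G e l p * currentP B.V p.2 v = 0 := by
  have h1 : familyOp G e l p * currentP B.V p.2 1 = 0 := by
    ext I r
    exact congrFun (familyOp_mulVec_currentP he hl hp r).1 I
  have h2 : familyOp G e l p * currentP B.V p.2 Complex.I = 0 := by
    ext I r
    exact congrFun (familyOp_mulVec_currentP he hl hp r).2 I
  rw [currentP_eq, Matrix.mul_add, Matrix.mul_smul, Matrix.mul_smul, h1, h2, smul_zero, smul_zero,
    add_zero]

/-- The columns of `familyOp * frame` are parallel vector fields. -/
theorem hasMatDeriv_familyOp_mul_frame (he : ∀ i, B.IsKilling G (e i)) {l : ℝ}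
    (hl : ∀ q : ℝ × ℂ, q.2 ∈ B.dom → ∑ i, spinorNormSq (e i q) = l) {p : ℝ × ℂ}
    (hp : p.2 ∈ B.dom) (X : ℝ × ℂ) :
    HasMatDeriv (fun q => familyOp G e l q * B.frame q.2)
      (-(connEight B.V p.2 X.2 * (familyOp G e l p * B.frame p.2))) p X := by
  refine ((hasMatDeriv_familyOp he l hp X).mul (B.hasMatDeriv_frame hp X)).congr_deriv ?_
  rw [Matrix.mul_add, ← Matrix.mul_assoc _ (currentP _ _ _), familyOp_mul_currentP he hl hp,
    Matrix.zero_mul, add_zero, Matrix.sub_mul, Matrix.mul_neg, Matrix.mul_assoc, Matrix.mul_assoc]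
  abel

theorem matSmoothOn_familyOp_mul_frame (he : ∀ i, B.IsKilling G (e i)) (l : ℝ) :
    MatSmoothOn (fun q => familyOp G e l q * B.frame q.2) (Set.univ ×ˢ B.dom) := by
  have h1 : MatSmoothOn (fun q => familyForm G fun i => e i q) (Set.univ ×ˢ B.dom) := by
    intro I J
    have hS : MatSmoothOn (fun q => G.mat I * (G.mat J)ᵀ * ∑ i, spinorWedge (e i q))
        (Set.univ ×ˢ B.dom) :=
      (matSmoothOn_const _).mul (MatSmoothOn.sum fun i =>
        ((he i).matSmoothOn.mul (matSmoothOn_const _)).mul (he i).matSmoothOn.transpose)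
    change ContDiffOn ℝ ∞
      (fun q => ∑ a, (G.mat I * (G.mat J)ᵀ * ∑ i, spinorWedge (e i q)) a a) _
    exact ContDiffOn.sum fun a _ => hS a a
  have h2 : MatSmoothOn (fun q : ℝ × ℂ => B.frame q.2) (Set.univ ×ˢ B.dom) := fun I a =>
    (B.smooth_V a (Sum.inl I)).comp contDiffOn_snd fun q hq => hq.2
  exact ((matSmoothOn_const _).add (h1.mul h1)).mul h2

/-- The Clifford action of two parallel vector fields on a spinor field. -/
def cliffordAct (B : TimelikeBackground n) (G : SpinEightGamma) (e : ι → ℝ × ℂ → Spinor) (l : ℝ)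
    (c d : Fin 8 ⊕ Fin n → ℝ) (ε : ℝ × ℂ → Spinor) (q : ℝ × ℂ) : Spinor := fun α =>
  slash G ((familyOp G e l q * B.frame q.2) *ᵥ c) *ᵥ
    ((slash G ((familyOp G e l q * B.frame q.2) *ᵥ d))ᵀ *ᵥ ε q α)

theorem spinorMatrix_cliffordAct (l : ℝ) (c d : Fin 8 ⊕ Fin n → ℝ) (ε : ℝ × ℂ → Spinor)
    (q : ℝ × ℂ) : spinorMatrix (cliffordAct B G e l c d ε q) =
      slash G ((familyOp G e l q * B.frame q.2) *ᵥ c) *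
        (slash G ((familyOp G e l q * B.frame q.2) *ᵥ d))ᵀ * spinorMatrix (ε q) := by
  ext A α
  rw [Matrix.mul_assoc]
  rfl

/-- Both vectors are parallel and orthogonal to `P`: the first property preserves the gravitino
equation, the second the dilatino equation. -/
theorem isKilling_cliffordAct (he : ∀ i, B.IsKilling G (e i)) {l : ℝ}
    (hl : ∀ q : ℝ × ℂ, q.2 ∈ B.dom → ∑ i, spinorNormSq (e i q) = l) (c d : Fin 8 ⊕ Fin n → ℝ)
    {ε : ℝ × ℂ → Spinor} (h : B.IsKilling G ε) : B.IsKilling G (cliffordAct B G e l c d ε) := by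
  have hZ := matSmoothOn_familyOp_mul_frame he l
  refine isKilling_of ?_ ?_ ?_ ?_
  · simp only [spinorMatrix_cliffordAct]
    exact ((hZ.slash G c).mul (hZ.slash G d).transpose).mul h.matSmoothOn
  · intro p hp
    ext α A
    simp [cliffordAct, h.eq_zero_outside p hp]
  · intro p hp X
    have hD := hasMatDeriv_familyOp_mul_frame he hl hp X
    simp only [spinorMatrix_cliffordAct]
    refine (((hD.slash G c).mul (hD.slash G d).transpose).mul (h.hasMatDeriv hp X)).congr_deriv ?_
    set Z := familyOp G e l p * B.frame p.2
    set Q := connEight B.V p.2 X.2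
    have hQ : Qᵀ = -Q := B.connEight_transpose hp X.2
    have hcomm := spinRep_mul_slash_mul_transpose G hQ (Z *ᵥ c) (Z *ᵥ d)
    rw [← Matrix.mul_assoc (spinRep G Q), hcomm, Matrix.neg_mulVec, Matrix.neg_mulVec,
      ← Matrix.mulVec_mulVec _ Q Z, ← Matrix.mulVec_mulVec _ Q Z, slash_neg, slash_neg,
      Matrix.transpose_neg]
    simp only [Matrix.add_mul, Matrix.mul_add, Matrix.sub_mul, Matrix.mul_neg, Matrix.neg_mul,
      Matrix.mul_smul, Matrix.mul_assoc]
    abel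
  · intro p hp r
    obtain ⟨h1, h2⟩ := familyOp_mulVec_currentP he hl hp r
    -- The operator is symmetric, so its range is orthogonal to its kernel, which contains `P`.
    have key : ∀ x : Fin 8 → ℝ, familyOp G e l p *ᵥ x = 0 → ∀ c,
        x ⬝ᵥ ((familyOp G e l p * B.frame p.2) *ᵥ c) = 0 := by
      intro x hx c
      rw [← Matrix.mulVec_mulVec, Matrix.dotProduct_mulVec, ← Matrix.mulVec_transpose,
        familyOp_transpose, hx, zero_dotProduct]
    exact (h.annihilates hp r).slash_mul (key _ h1 c) (key _ h2 c) (key _ h1 d) (key _ h2 d)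
      fun α => rfl

end Family

/-- The complex structure preserves Killing spinors. -/
theorem IsKilling.complexStructure {ε : ℝ × ℂ → Spinor} (h : B.IsKilling G ε) :
    B.IsKilling G fun q => ![ε q 1, -ε q 0] := by
  have hm : ∀ q, spinorMatrix ![ε q 1, -ε q 0] = spinorMatrix (ε q) * gammaOneTwo := by
    intro q
    rw [gammaOneTwo_eq]
    ext A α
    fin_cases α <;> simp [spinorMatrix, Matrix.mul_apply]
  refine isKilling_of ?_ ?_ ?_ ?_
  · simp only [hm]
    exact h.matSmoothOn.mul (matSmoothOn_const _)
  · intro p hp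
    ext α A
    fin_cases α <;> simp [h.eq_zero_outside p hp]
  · intro p hp X
    simp only [hm]
    refine ((h.hasMatDeriv hp X).mul (hasMatDeriv_const gammaOneTwo)).congr_deriv ?_
    rw [gammaOneTwo_transpose]
    simp only [Matrix.mul_zero, add_zero, Matrix.add_mul, Matrix.smul_mul, Matrix.mul_neg,
      Matrix.neg_mul, Matrix.mul_assoc]
  · intro p hp r
    obtain ⟨h1, h2⟩ := h.annihilates hp r
    constructor
    · simp only [Matrix.cons_val_zero, Matrix.cons_val_one, Matrix.mulVec_neg]
      rw [← neg_eq_zero, ← h2]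
      abel
    · simp only [Matrix.cons_val_zero, Matrix.cons_val_one, Matrix.mulVec_neg]
      rw [← h1]
      abel

theorem spinorEquiv_complexStructure (ε : Spinor) :
    spinorEquiv ![ε 1, -ε 0] = Complex.I • spinorEquiv ε := by
  ext A
  apply Complex.ext <;> simp [spinorEquiv_apply]

end TimelikeBackground

/-! ### The complex space of values of Killing spinors at a point -/

theorem slash_complexVec (G : SpinEightGamma) (s : Fin 8 → ℝ) :
    slash G (complexVec s) = (slash G s).map (algebraMap ℝ ℂ) := by
  ext A a
  simp [slash, complexVec_apply, Matrix.sum_apply]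

theorem map_mulVec_spinorEquiv (M : Matrix (Fin 8) (Fin 8) ℝ) (ε : Spinor) :
    spinorEquiv (fun α => M *ᵥ ε α) = M.map (algebraMap ℝ ℂ) *ᵥ spinorEquiv ε := by
  ext A
  simp only [spinorEquiv_apply, Matrix.mulVec, dotProduct, Matrix.map_apply, Complex.coe_algebraMap]
  push_cast
  rw [Finset.mul_sum, ← Finset.sum_sub_distrib]
  refine Finset.sum_congr rfl fun B _ => ?_
  ring

namespace TimelikeBackground

variable {n : ℕ} {B : TimelikeBackground n} {G : SpinEightGamma}

/-- The value of a Killing spinor at a point, as a complex spinor. -/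
noncomputable def evalKilling (B : TimelikeBackground n) (G : SpinEightGamma) (z : ℂ) :
    B.killingSpinors G →ₗ[ℝ] (Fin 8 → ℂ) where
  toFun ε := spinorEquiv (ε.1 (0, z))
  map_add' _ _ := map_add spinorEquiv _ _
  map_smul' _ _ := map_smul spinorEquiv _ _

/-- The norm is constant on the connected domain, so a Killing spinor that vanishes at one point of
it vanishes identically. -/
theorem evalKilling_injective {z : ℂ} (hz : z ∈ B.dom) :
    Function.Injective (evalKilling B G z) := by
  rw [← LinearMap.ker_eq_bot, LinearMap.ker_eq_bot']
  rintro ⟨ε, hε⟩ h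
  have hε' : B.IsKilling G ε := hε
  have h0 : ε (0, z) = 0 := spinorEquiv.map_eq_zero_iff.1 h
  apply Subtype.ext
  funext p
  by_cases hp : p.2 ∈ B.dom
  · apply spinorNormSq_eq_zero
    rw [hε'.spinorNormSq_eq hp (q := (0, z)) hz, h0]
    simp [spinorNormSq]
  · exact hε'.eq_zero_outside p hp

/-- The complex space of values of Killing spinors at a point. -/
def killingValues (B : TimelikeBackground n) (G : SpinEightGamma) (z : ℂ) :
    Submodule ℂ (Fin 8 → ℂ) where
  carrier := Set.range (evalKilling B G z)
  zero_mem' := ⟨0, map_zero _⟩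
  add_mem' := by
    rintro _ _ ⟨ε, rfl⟩ ⟨ε', rfl⟩
    exact ⟨ε + ε', map_add _ _ _⟩
  smul_mem' := by
    rintro c _ ⟨ε, rfl⟩
    let ε' : B.killingSpinors G := ⟨_, IsKilling.complexStructure ε.2⟩
    have h : evalKilling B G z ε' = Complex.I • evalKilling B G z ε :=
      spinorEquiv_complexStructure _
    refine ⟨c.re • ε + c.im • ε', ?_⟩
    rw [map_add, map_smul, map_smul, h]
    conv_rhs => rw [← Complex.re_add_im c]
    rw [add_smul, mul_smul]
    rfl

theorem numKilling_eq {z : ℂ} (hz : z ∈ B.dom) :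
    B.numKilling G = 2 * Module.finrank ℂ (killingValues B G z) := by
  rw [← finrank_real_of_complex, numKilling,
    ← LinearMap.finrank_range_of_inj (evalKilling_injective (G := G) hz)]
  rfl

theorem killingValues_le_posKer {z : ℂ} (hz : z ∈ B.dom) :
    killingValues B G z ≤ posKer G (columnSpan (B.Pz z)) := by
  rintro _ ⟨ε, rfl⟩
  rw [columnSpan, mem_posKer_span]
  rintro _ ⟨r, rfl⟩
  have h := IsKilling.annihilates (p := (0, z)) ε.2 hz r
  rw [← dilatino_eq_zero_iff_annihilates, dilatino_eq_zero_iff] at h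
  exact h

theorem numKilling_le {z : ℂ} (hz : z ∈ B.dom) :
    B.numKilling G ≤ numSupersymmetries G (B.Pz z) := by
  rw [numKilling_eq hz, numSupersymmetries_eq]
  exact Nat.mul_le_mul_left 2 (Submodule.finrank_mono (killingValues_le_posKer hz))

theorem evalKilling_cliffordAct {ι : Type*} [Fintype ι] {e : ι → ℝ × ℂ → Spinor} {l : ℝ}
    (c d : Fin 8 ⊕ Fin n → ℝ) (ε : ℝ × ℂ → Spinor) (p : ℝ × ℂ) :
    spinorEquiv (cliffordAct B G e l c d ε p) =
      slash G (complexVec (familyOp G e l p *ᵥ (B.frame p.2 *ᵥ c))) *ᵥ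
        ((slash G (complexVec (familyOp G e l p *ᵥ (B.frame p.2 *ᵥ d))))ᵀ *ᵥ
          spinorEquiv (ε p)) := by
  rw [slash_complexVec, slash_complexVec, ← Matrix.transpose_map, ← map_mulVec_spinorEquiv,
    ← map_mulVec_spinorEquiv, Matrix.mulVec_mulVec, Matrix.mulVec_mulVec]
  rfl

/-- The operator `l + i b` on real vectors, where `b` is the two-form of a family of spinors. -/
noncomputable def familyEmbedding {ι : Type*} [Fintype ι] (G : SpinEightGamma) (η : ι → Spinor) (l : ℝ) :
    (Fin 8 → ℝ) →ₗ[ℝ] (Fin 8 → ℂ) where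
  toFun s := complexVec (l • s) - Complex.I • complexVec (-(familyForm G η *ᵥ s))
  map_add' s t := by
    rw [smul_add, Matrix.mulVec_add, neg_add, map_add, map_add, smul_add]
    abel
  map_smul' c s := by
    rw [smul_comm, Matrix.mulVec_smul, ← smul_neg, complexVec.map_smul c, complexVec.map_smul c,
      smul_comm Complex.I,
      ← smul_sub]
    rfl

theorem familyEmbedding_eq_zero {ι : Type*} [Fintype ι] {η : ι → Spinor} {l : ℝ} (hl : l ≠ 0)
    {s : Fin 8 → ℝ} (h : familyEmbedding G η l s = 0) : s = 0 := by
  ext I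
  have h1 := congrArg Complex.re (congrFun h I)
  simpa [familyEmbedding, complexVec_apply, hl] using h1

/-- On the kernel `b² s = -l² s`, hence `|b s|² = l² |s|²`. The pair `(l s, -b s)` is then an
equality case of the sum-of-squares identity: both sides are `2 l³ |s|²`. -/
theorem slash_familyEmbedding {ι : Type*} [Fintype ι] {e : ι → ℝ × ℂ → Spinor} {p : ℝ × ℂ}
    {l : ℝ} (hl : ∑ i, spinorNormSq (e i p) = l) {s : Fin 8 → ℝ}
    (hs : familyOp G e l p *ᵥ s = 0) (i : ι) :
    (slash G (familyEmbedding G (fun i => e i p) l s))ᵀ *ᵥ spinorEquiv (e i p) = 0 := by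
  refine (annihilates_iff G _ _ _).1 (annihilates_of_familyForm (η := fun i => e i p) ?_ i)
  rw [hl]
  set b := familyForm G fun i => e i p with hb
  have hbT : bᵀ = -b := familyForm_transpose _ _
  have h1 : b *ᵥ (b *ᵥ s) = -((l ^ 2) • s) := by
    rw [familyOp, Matrix.add_mulVec, Matrix.smul_mulVec, Matrix.one_mulVec,
      ← Matrix.mulVec_mulVec] at hs
    exact eq_neg_of_add_eq_zero_right hs
  have h2 : (b *ᵥ s) ⬝ᵥ (b *ᵥ s) = l ^ 2 * (s ⬝ᵥ s) := by
    rw [Matrix.dotProduct_mulVec, ← Matrix.mulVec_transpose, hbT, Matrix.neg_mulVec, h1, neg_neg,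
      smul_dotProduct, smul_eq_mul]
  rw [Matrix.mulVec_neg, h1, neg_neg, neg_dotProduct_neg, h2]
  simp only [smul_dotProduct, dotProduct_smul, smul_eq_mul]
  ring

theorem finrank_killingValues_mem (h : B.IsSupersymmetric G) {z : ℂ} (hz : z ∈ B.dom) :
    Module.finrank ℂ (killingValues B G z) ∈ ({8, 4, 2, 1} : Set ℕ) := by
  have hinj := evalKilling_injective (G := G) hz
  have : Module.Finite ℝ (B.killingSpinors G) := Module.Finite.of_injective _ hinj
  let b := Module.finBasis ℝ (B.killingSpinors G)
  -- The family is a full basis, so a vector that annihilates its values annihilates all values of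
  -- Killing spinors.
  let e : Fin (Module.finrank ℝ (B.killingSpinors G)) → ℝ × ℂ → Spinor := fun i => (b i).1
  have he : ∀ i, B.IsKilling G (e i) := fun i => (b i).2
  let l : ℝ := ∑ i, spinorNormSq (e i (0, z))
  have hl : ∀ q : ℝ × ℂ, q.2 ∈ B.dom → ∑ i, spinorNormSq (e i q) = l := fun q hq =>
    Finset.sum_congr rfl fun i _ => (he i).spinorNormSq_eq hq hz
  obtain ⟨ε₀, hε₀, hne⟩ := h
  have hev : evalKilling B G z ⟨ε₀, hε₀⟩ ≠ 0 := by
    intro h0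
    exact hne (congrArg Subtype.val (hinj (h0.trans (map_zero _).symm)))
  -- If all basis spinors vanished at `z`, evaluation would be zero, against the nonzero Killing
  -- spinor.
  have hl0 : l ≠ 0 := by
    intro hl0
    have h1 := (Finset.sum_eq_zero_iff_of_nonneg fun i _ => spinorNormSq_nonneg _).1 hl0
    have h2 : evalKilling B G z = 0 := b.ext fun i => by
      change spinorEquiv (e i (0, z)) = 0
      rw [spinorNormSq_eq_zero (h1 i (Finset.mem_univ i)), map_zero]
    exact hev (by rw [h2, LinearMap.zero_apply])
  refine finrank_mem_of_invariant G (fun hbot => ?_) (familyOp G e l (0, z)).mulVecLin ?_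
    (familyEmbedding G (fun i => e i (0, z)) l) ?_ fun s => familyEmbedding_eq_zero hl0
  · have h1 : evalKilling B G z ⟨ε₀, hε₀⟩ ∈ killingValues B G z := ⟨_, rfl⟩
    rw [hbot, Submodule.mem_bot] at h1
    exact hev h1
  · rintro s t _ ⟨ε, rfl⟩
    -- Arbitrary vectors at `z` extend to constant combinations of the frame, so the algebraic
    -- action at `z` comes from Killing spinors.
    obtain ⟨c, rfl⟩ := B.frame_mulVec_surjective hz s
    obtain ⟨d, rfl⟩ := B.frame_mulVec_surjective hz t
    exact ⟨⟨_, isKilling_cliffordAct he hl c d ε.2⟩, evalKilling_cliffordAct c d ε.1 (0, z)⟩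
  · rintro s hs _ ⟨ε, rfl⟩
    have h1 : (slash G (familyEmbedding G (fun i => e i (0, z)) l s))ᵀ.mulVecLin.restrictScalars ℝ
        ∘ₗ evalKilling B G z = 0 :=
      b.ext fun i => slash_familyEmbedding (hl (0, z) hz) hs i
    exact LinearMap.congr_fun h1 ε

theorem numKilling_mem (h : B.IsSupersymmetric G) :
    B.numKilling G ∈ ({16, 8, 4, 2} : Set ℕ) := by
  obtain ⟨z, hz⟩ := B.isConnected_dom.nonempty
  rw [numKilling_eq hz]
  have h1 := finrank_killingValues_mem h hz
  simp only [Set.mem_insert_iff, Set.mem_singleton_iff] at h1 ⊢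
  omega

end TimelikeBackground

end TimelikeSugra

theorem mainTheorem2 (n : ℕ) (G : TimelikeSugra.SpinEightGamma) :
    (∀ B : TimelikeSugra.TimelikeBackground n, B.IsSupersymmetric G →
      B.numKilling G ∈ ({16, 8, 4, 2} : Set ℕ) ∧
      ∀ z ∈ B.dom, B.numKilling G ≤ TimelikeSugra.numSupersymmetries G (B.Pz z)) ∧
    (∀ P : Matrix (Fin 8) (Fin n) ℂ, TimelikeSugra.IsSupersymmetric G P →
      TimelikeSugra.numSupersymmetries G P ∈ ({16, 8, 4, 2} : Set ℕ)) ∧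
    (∀ μ ν : ℕ, μ + ν ≤ 4 → 2 * μ + ν ≤ n →
      (TimelikeSugra.nilpotentClass G n μ ν).Nonempty) ∧
    (∀ μ ν : ℕ, ∀ P ∈ TimelikeSugra.nilpotentClass G n μ ν,
      (μ + ν < 4 → TimelikeSugra.numSupersymmetries G P = 16 / 2 ^ (μ + ν)) ∧
      (μ + ν = 4 → TimelikeSugra.numSupersymmetries G P = 2)) := by
  refine ⟨fun B hB => ⟨TimelikeSugra.TimelikeBackground.numKilling_mem hB,
    fun z hz => TimelikeSugra.TimelikeBackground.numKilling_le hz⟩,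
    fun P hP => hP.numSupersymmetries_mem,
    fun μ ν h hn => TimelikeSugra.nilpotentClass_nonempty G h hn, fun μ ν P hP => ?_⟩
  have hr := TimelikeSugra.rank_of_mem_nilpotentClass hP
  have hs : TimelikeSugra.IsSupersymmetric G P := hP.2.2.1
  rw [← hr]
  exact ⟨hs.numSupersymmetries_of_lt, hs.numSupersymmetries_of_eq⟩
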